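/- Let $r$ be a non-negative integer and let $\gamma_1,\dots,\gamma_r\in\mathbb{C}$ with $\Re\gamma_j>0$ for all $j$. Write $y_j=\gamma_j\sum_{k=j}^r t_k$, and for real $c\ne 1$ put $$\widetilde{\mathfrak H}_r((t_j);(\gamma_j);c)=\prod_{j=1}^r\left(\frac{1}{e^{y_j}-1}-\frac{c}{e^{c y_j}-1}\right)$$ (removable singularities at $y_j=0$ are filled in). Let $\mathcal C$ be the Hankel contour: from $+\infty$ to $\varepsilon$ on the top side of the positive real axis ($\arg t=0$), once counterclockwise around the circle $|t|=\varepsilon$, and from $\varepsilon$ back to $+\infty$ on the bottom side ($\arg t=2\pi$), with $\varepsilon>0$ sufficiently small. The desingularized multiple zeta-function is $$\zeta_r^{\rm des}((s_j);(\gamma_j))=\lim_{\substack{c\to1\\ c\in\mathbb{R}\setminus\{1\}}}\frac{(-1)^r}{(c-1)^r}\prod_{k=1}^r\frac{1}{(e^{2\pi i s_k}-1)\Gamma(s_k)}\int_{\mathcal C^r}\widetilde{\mathfrak H}_r((t_j);(\gamma_j);c)\prod_{k=1}^r t_k^{s_k-1}\,dt_k$$ for $(s_j)\in\mathbb{C}^r$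 without integral coordinates, and at points with integral coordinates it is the continuous extension of this function. **Theorem.** (0) For all sufficiently small $\varepsilon>0$ the following holds. If no $s_j$ is an integer, the integral converges absolutely for all real $c\neq 1$ close to $1$ and the limit as $c\to1$ exists. For all integers $k_1,\dots,k_r\ge0$ the resulting function of $(s_j)$ has a limit as $(s_j)\to(-k_j)$ through points without integral coordinates, and this limit, which is $\zeta_r^{\rm des}((-k_j);(\gamma_j))$, does not depend on $\varepsilon$. (1) For all $(t_j)$ in a neighbourhood of the origin of $\mathbb{C}^r$, $$\prod_{j=1}^r\frac{(1-y_j)e^{y_j}-1}{(e^{y_j}-1)^2}=\sum_{m_1,\dots,m_r=0}^\infty(-1)^{m_1+\cdots+m_r}\,\zeta_r^{\rm des}((-m_j);(\gamma_j))\prod_{j=1}^r\frac{t_j^{m_j}}{m_j!},$$ where the series converges absolutely and the factors on the left take the value $-\tfrac12$ (the limit) at $y_j=0$. (2) For all integers $k_1,\dots,k_r\ge0$, $$\zeta_r^{\rm des}((-k_j);(\gamma_j))=\prod_{l=1}^r(-1)^{k_l}k_l!\;\sum_{(\nu_{dj})}\ \prod_{j=1}^r\left(B_{1+\sum_{l=j}^r\nu_{jl}}\;\gamma_j^{\sum_{l=j}^r\nu_{jl}}\;\frac{1}{\prod_{d=1}^j\nu_{dj}!}\right),$$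 where the sum runs over all families of integers $\nu_{dj}\ge0$ $(1\le d\le j\le r)$ with $\sum_{d=1}^j\nu_{dj}=k_j$ for $1\le j\le r$, and the Bernoulli numbers are defined by $\frac{t}{e^t-1}=\sum_{n\ge0}B_n\frac{t^n}{n!}$. -/

import Mathlib

open Filter Topology MeasureTheory
open scoped Nat

noncomputable section

namespace DesZeta

/-- Modulus of the point with parameter `u` on the Hankel contour of radius `ε`. -/
def hankelRadius (ε u : ℝ) : ℝ := ε + max 0 (-u) + max 0 (u - 2 * Real.pi)

/-- Argument (from `0` to `2π`) along the Hankel contour. -/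
def hankelArg (u : ℝ) : ℝ := max 0 (min u (2 * Real.pi))

/-- The Hankel contour of radius `ε`, parametrized by `u ∈ ℝ`: for `u ≤ 0` it runs from `+∞` to `ε`
on the top side of the positive real axis, for `0 ≤ u ≤ 2π` once counterclockwise around the circle
`|t| = ε`, and for `u ≥ 2π` back from `ε` to `+∞` on the bottom side. -/
def hankelPath (ε u : ℝ) : ℂ := hankelRadius ε u * Complex.exp (hankelArg u * Complex.I)

/-- The branch of `log t` along the Hankel contour: argument `0` on the top side, `2π` on the
bottom side. -/
def hankelLog (ε u : ℝ) : ℂ := Real.log (hankelRadius ε u) + hankelArg u * Complex.I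

/-- The integrand of `∫_{C^r} G(t) ∏ₖ tₖ^(sₖ - 1) dtₖ` in the parameters `u ∈ ℝ^r`. -/
def hankelIntegrand {r : ℕ} (ε : ℝ) (G : (Fin r → ℂ) → ℂ) (s : Fin r → ℂ) (u : Fin r → ℝ) : ℂ :=
  G (fun k => hankelPath ε (u k)) *
    ∏ k, (Complex.exp ((s k - 1) * hankelLog ε (u k)) * deriv (hankelPath ε) (u k))

/-- `∫_{C^r} G(t) ∏ₖ tₖ^(sₖ - 1) dtₖ`, with `C` the Hankel contour of radius `ε`. -/
def hankelIntegral {r : ℕ} (ε : ℝ) (G : (Fin r → ℂ) → ℂ) (s : Fin r → ℂ) : ℂ :=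
  ∫ u : Fin r → ℝ, hankelIntegrand ε G s u

/-- `y_j = γ_j ∑_{k ≥ j} t_k`. -/
def tailSum {r : ℕ} (γ t : Fin r → ℂ) (j : Fin r) : ℂ := γ j * ∑ k ∈ Finset.Ici j, t k

/-- `1 / (e^y - 1) - c / (e^(cy) - 1)`, with its removable singularity at `y = 0` filled in by the
limit `(c - 1) / 2`. -/
def regFactor (c : ℝ) (y : ℂ) : ℂ :=
  if y = 0 then ((c : ℂ) - 1) / 2
  else 1 / (Complex.exp y - 1) - c / (Complex.exp (c * y) - 1)

/-- The function `H̃_r((t_j); (γ_j); c)`. -/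
def regProduct {r : ℕ} (γ : Fin r → ℂ) (c : ℝ) (t : Fin r → ℂ) : ℂ :=
  ∏ j, regFactor c (tailSum γ t j)

/-- `((1 - y) e^y - 1) / (e^y - 1)^2`, with its removable singularity at `y = 0` filled in by the
limit `-1/2`. -/
def genFactor (y : ℂ) : ℂ :=
  if y = 0 then -1 / 2
  else ((1 - y) * Complex.exp y - 1) / (Complex.exp y - 1) ^ 2

/-- The points of `ℂ^r` none of whose coordinates is an integer. -/
def nonIntegral (r : ℕ) : Set (Fin r → ℂ) := {s | ∀ k, ∀ n : ℤ, s k ≠ n}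

/-- The expression under `lim_{c → 1}` in the definition of the desingularized multiple
zeta-function (meaningful when no `s_k` is an integer), with Hankel contour of radius `ε`. -/
def desZetaApprox {r : ℕ} (ε : ℝ) (γ : Fin r → ℂ) (c : ℝ) (s : Fin r → ℂ) : ℂ :=
  (-1) ^ r / ((c : ℂ) - 1) ^ r *
    (∏ k, 1 / ((Complex.exp (2 * Real.pi * Complex.I * s k) - 1) * Complex.Gamma (s k))) *
    hankelIntegral ε (regProduct γ c) s

/-- The limit as `c → 1`, `c ∈ ℝ \ {1}`, for `s` without integral coordinates. -/
def desZetaGeneric {r : ℕ} (ε : ℝ) (γ : Fin r → ℂ) (s : Fin r → ℂ) : ℂ :=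
  limUnder (𝓝[≠] (1 : ℝ)) (fun c => desZetaApprox ε γ c s)

/-- The desingularized multiple zeta-function `ζ_r^des((s_j); (γ_j))` on `ℂ^r`. At points with
integral coordinates, where the factors `(e^(2πis) - 1) Γ(s)` degenerate, it is the continuous
(equivalently, the analytic) extension of the contour integral formula from the dense set
`nonIntegral r`. The outer limit expresses that the radius `ε` is taken sufficiently small. -/
def desZeta {r : ℕ} (γ : Fin r → ℂ) (s : Fin r → ℂ) : ℂ :=
  limUnder (𝓝[>] (0 : ℝ)) fun ε => limUnder (𝓝[nonIntegral r] s) (desZetaGeneric ε γ)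

/-- The index set of all `(ν_{dj})_{1 ≤ d ≤ j ≤ r}` in `ℕ` with `∑_{d ≤ j} ν_{dj} = k_j` for all
`j`. The entry `ν_{dj}` is `ν j d`, and `ν j d = 0` for `d > j`. -/
def nuIndex {r : ℕ} (k : Fin r → ℕ) : Finset (Fin r → Fin r → ℕ) :=
  Fintype.piFinset fun j => Finset.piAntidiag (Finset.Iic j) (k j)

end DesZeta

end

/-! For fixed `y`, the function `x ↦ x / (e^(xy) - 1)` has derivative `genFactor (x * y)`, and
`regFactor c y` is its value at `1` minus its value at `c`. Hence `regFactor c y / (c - 1)` tends to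
`-genFactor y`, and the normalised integrand tends pointwise to the one built from `genProduct`.

Dominated convergence carries this to the integrals. On the contour each `y_j` has the form `γ_j (X
+ W)` with `X ≥ 0` real and `W` small. There `genFactor` has no pole and decays exponentially in
`X`, because `Re γ_j > 0` (`exists_norm_genFactor_le`); the mean value inequality transfers the
bound to `regFactor`, with a factor `|c - 1|`. Since `X` dominates the distance travelled by `t_j`
along its ray, the `j`-th factor supplies decay in `u_j`, and the product of the bounds is
integrable on `ℝ^r` (`tailSum_hankelPath`, `integrable_hankelMajorant`).

By the reflection formula the factor `1 / ((e^(2πis) - 1) Γ(s))` equals `Γ(1 - s) e^(-πis) / (2πi)`,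
which is continuous at the non-positive integers, with value `(-1)^k k! / (2πi)` at `-k`. At `s =
(-k_j)` the powers `t^(-k-1)` are single-valued, so the two rays of each contour cancel
(`integral_eq_setIntegral_of_reflect_neg`), and the remaining circles extract the Taylor coefficient
of `genProduct` at `t^k` (`setIntegral_circles`). The value is therefore `∏ (-1)^(k_l) k_l!` times
this coefficient, whatever the radius, which gives the generating function.

For the explicit formula, `genFactor` is the derivative of `y / (e^y - 1)`, so that `genFactor y = ∑
B_(n+1) y^n / n!`. Expanding each `y_j^n` multinomially and multiplying the `r` series identifies
the coefficients with `genCoeff`. -/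

namespace DesZeta

/-! ### Power series evaluated at a complex number -/

/-- Cauchy product: convergence in `ℂ` is unconditional, hence absolute. This and its companions
allow an identity of formal power series to be evaluated at `z`. -/
theorem hasSum_coeff_mul {p q : PowerSeries ℂ} {z a b : ℂ}
    (hp : HasSum (fun n => PowerSeries.coeff n p * z ^ n) a)
    (hq : HasSum (fun n => PowerSeries.coeff n q * z ^ n) b) :
    HasSum (fun n => PowerSeries.coeff n (p * q) * z ^ n) (a * b) := by
  have h1 := summable_norm_sum_mul_antidiagonal_of_summable_norm hp.summable.norm hq.summable.norm
  have h2 := tsum_mul_tsum_eq_tsum_sum_antidiagonal_of_summable_norm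
    hp.summable.norm hq.summable.norm
  rw [hp.tsum_eq, hq.tsum_eq] at h2
  rw [h2]
  convert! h1.of_norm.hasSum using 1
  funext n
  rw [PowerSeries.coeff_mul, Finset.sum_mul]
  refine Finset.sum_congr rfl fun x hx => ?_
  rw [← Finset.HasAntidiagonal.mem_antidiagonal.mp hx, pow_add]
  ring

theorem hasSum_coeff_exp (z : ℂ) :
    HasSum (fun n => PowerSeries.coeff n (PowerSeries.exp ℂ) * z ^ n) (Complex.exp z) := by
  have h := NormedSpace.expSeries_div_hasSum_exp (𝔸 := ℂ) z
  rw [← Complex.exp_eq_exp_ℂ] at h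
  convert! h using 1
  funext n
  simp [PowerSeries.coeff_exp, div_eq_mul_inv, mul_comm]

theorem hasSum_coeff_one (z : ℂ) :
    HasSum (fun n => PowerSeries.coeff n (1 : PowerSeries ℂ) * z ^ n) 1 := by
  convert hasSum_ite_eq 0 (1 : ℂ) using 1
  funext n
  by_cases h : n = 0 <;> simp [PowerSeries.coeff_one, h]

theorem hasSum_coeff_X (z : ℂ) :
    HasSum (fun n => PowerSeries.coeff n (PowerSeries.X : PowerSeries ℂ) * z ^ n) z := by
  convert hasSum_ite_eq 1 z using 1
  funext n
  by_cases h : n = 1 <;> simp [PowerSeries.coeff_X, h]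

theorem hasSum_coeff_sub {p q : PowerSeries ℂ} {z a b : ℂ}
    (hp : HasSum (fun n => PowerSeries.coeff n p * z ^ n) a)
    (hq : HasSum (fun n => PowerSeries.coeff n q * z ^ n) b) :
    HasSum (fun n => PowerSeries.coeff n (p - q) * z ^ n) (a - b) := by
  convert! hp.sub hq using 1
  funext n
  simp [sub_mul]

/-! ### The Bernoulli series -/

/-- Strong induction on `(n+1) B_n = -∑_{k<n} C(n+1,k) B_k`: by induction the `k`-th term is at most
`(n+1)! / (n+1-k)! ≤ (n+1)! 2^(-(n-k))`, and these powers of `1/2` sum to at most `1`. The bound is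
crude, but convergence for `‖y‖ < 1` suffices below. -/
theorem abs_bernoulli_le_factorial (n : ℕ) : |bernoulli n| ≤ n ! := by
  induction n using Nat.strong_induction_on with
  | _ n ih =>
    rcases Nat.eq_zero_or_pos n with rfl | hn
    · simp
    have hs := sum_bernoulli (n + 1)
    rw [Finset.sum_range_succ, if_neg (by omega)] at hs
    have hc : ((n + 1).choose n : ℚ) = n + 1 := by
      rw [Nat.choose_succ_self_right]; push_cast; ring
    rw [hc] at hs
    have hb : (n + 1 : ℚ) * bernoulli n = -∑ k ∈ Finset.range n, ((n + 1).choose k : ℚ) * bernoulli k := by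
      linarith
    have hterm : ∀ k ∈ Finset.range n, |((n + 1).choose k : ℚ) * bernoulli k| ≤
        (n + 1)! * (1 / 2) ^ (n - k) := by
      intro k hk
      have hk' := Finset.mem_range.mp hk
      rw [abs_mul, Nat.abs_cast]
      have h1 : ((n + 1).choose k : ℚ) * k ! * (n + 1 - k)! = (n + 1)! := by
        exact_mod_cast Nat.choose_mul_factorial_mul_factorial (by omega : k ≤ n + 1)
      have h2 : (2 : ℚ) ^ (n - k) ≤ (n + 1 - k)! := by
        have h3 : 2 ^ (n - k) ≤ (n - k + 1)! := by
          have : ∀ m : ℕ, 2 ^ m ≤ (m + 1)! := by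
            intro m
            induction m with
            | zero => simp
            | succ m im =>
              rw [pow_succ, Nat.factorial_succ (m + 1), mul_comm]
              exact Nat.mul_le_mul (by omega) im
          exact this _
        rw [show n + 1 - k = n - k + 1 by omega]
        exact_mod_cast h3
      calc ((n + 1).choose k : ℚ) * |bernoulli k| ≤ (n + 1).choose k * k ! :=
            mul_le_mul_of_nonneg_left (ih k hk') (by positivity)
        _ = ((n + 1).choose k * k ! * 2 ^ (n - k)) * (1 / 2) ^ (n - k) := by
            rw [mul_assoc _ ((2 : ℚ) ^ _), ← mul_pow]; norm_num
        _ ≤ _ := by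
            rw [← h1]
            gcongr
    have hgeom : ∑ k ∈ Finset.range n, (1 / 2 : ℚ) ^ (n - k) ≤ 1 := by
      have : ∀ m : ℕ, ∑ k ∈ Finset.range m, (1 / 2 : ℚ) ^ (m - k) = 1 - (1 / 2) ^ m := by
        intro m
        induction m with
        | zero => simp
        | succ m im =>
          rw [Finset.sum_range_succ, show m + 1 - m = 1 by omega]
          have : ∑ k ∈ Finset.range m, (1 / 2 : ℚ) ^ (m + 1 - k) =
              1 / 2 * ∑ k ∈ Finset.range m, (1 / 2 : ℚ) ^ (m - k) := by
            rw [Finset.mul_sum]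
            refine Finset.sum_congr rfl fun k hk => ?_
            rw [show m + 1 - k = (m - k) + 1 by have := Finset.mem_range.mp hk; omega, pow_succ]
            ring
          rw [this, im, pow_succ]
          ring
      rw [this]
      have : (0 : ℚ) ≤ (1 / 2) ^ n := by positivity
      linarith
    have habs : (n + 1 : ℚ) * |bernoulli n| ≤ (n + 1) * n ! := by
      calc (n + 1 : ℚ) * |bernoulli n| = |(n + 1 : ℚ) * bernoulli n| := by
            rw [abs_mul, abs_of_nonneg (by positivity : (0 : ℚ) ≤ n + 1)]
        _ ≤ ∑ k ∈ Finset.range n, |((n + 1).choose k : ℚ) * bernoulli k| := by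
            rw [hb, abs_neg]; exact Finset.abs_sum_le_sum_abs _ _
        _ ≤ ∑ k ∈ Finset.range n, (n + 1)! * (1 / 2 : ℚ) ^ (n - k) := Finset.sum_le_sum hterm
        _ ≤ (n + 1)! * 1 := by
            rw [← Finset.mul_sum]; gcongr
        _ = _ := by rw [mul_one, Nat.factorial_succ]; push_cast; ring
    exact le_of_mul_le_mul_left habs (by positivity)

theorem norm_bernoulli_le_factorial (n : ℕ) : ‖(bernoulli n : ℂ)‖ ≤ n ! := by
  have := abs_bernoulli_le_factorial n
  rw [← Complex.ofReal_ratCast, Complex.norm_real, Real.norm_eq_abs]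
  exact_mod_cast this

theorem summable_norm_bernoulli_mul_pow {x : ℝ} (h0 : 0 ≤ x) (h1 : x < 1) :
    Summable fun n : ℕ => ‖(bernoulli (n + 1) : ℂ)‖ * x ^ n / n ! := by
  have h := summable_choose_mul_geometric_of_norm_lt_one 1
    (show ‖x‖ < 1 by rwa [Real.norm_of_nonneg h0])
  refine Summable.of_nonneg_of_le (fun n => by positivity) (fun n => ?_) h
  rw [Nat.choose_one_right, div_le_iff₀ (by positivity)]
  calc ‖(bernoulli (n + 1) : ℂ)‖ * x ^ n ≤ (n + 1)! * x ^ n := by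
        gcongr; exact norm_bernoulli_le_factorial _
    _ = _ := by rw [Nat.factorial_succ]; push_cast; ring

theorem exp_sub_one_ne_zero {y : ℂ} (h0 : y ≠ 0) (h : ‖y‖ < 2 * Real.pi) : Complex.exp y - 1 ≠ 0 := by
  intro he
  obtain ⟨n, hn⟩ := Complex.exp_eq_one_iff.mp (sub_eq_zero.mp he)
  have hn0 : n ≠ 0 := by rintro rfl; simp at hn; exact h0 hn
  have h1 : (1 : ℝ) ≤ |(n : ℝ)| := by exact_mod_cast Int.one_le_abs hn0
  rw [hn] at h
  simp only [norm_mul, Complex.norm_intCast, Complex.norm_ofNat, Complex.norm_real, Complex.norm_I,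
    Real.norm_eq_abs, abs_of_pos Real.pi_pos, mul_one] at h
  nlinarith [Real.pi_pos]

/-- Differentiating `b (E - 1) = X` formally, with `E` the exponential series, and multiplying by `E
- 1` gives `b' (E - 1)² = (E - 1) - X E`. Evaluating at `y` and dividing by `(e^y - 1)² ≠ 0` yields
the sum of `b'`. -/
theorem hasSum_genFactor {y : ℂ} (hy : ‖y‖ < 1) :
    HasSum (fun n : ℕ => (bernoulli (n + 1) : ℂ) * y ^ n / n !) (genFactor y) := by
  have hsum : Summable fun n : ℕ => (bernoulli (n + 1) : ℂ) * y ^ n / n ! := by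
    refine Summable.of_norm ?_
    simpa using summable_norm_bernoulli_mul_pow (norm_nonneg y) hy
  rcases eq_or_ne y 0 with rfl | h0
  · have := hasSum_single (f := fun n : ℕ => (bernoulli (n + 1) : ℂ) * 0 ^ n / n !) 0
      (fun n hn => by simp [hn])
    simpa [genFactor, neg_div] using this
  set b := bernoulliPowerSeries ℂ
  have hE : b * (PowerSeries.exp ℂ - 1) = PowerSeries.X := bernoulliPowerSeries_mul_exp_sub_one ℂ
  have hD := congrArg (PowerSeries.derivative ℂ) hE
  rw [Derivation.leibniz, map_sub, PowerSeries.derivative_exp, PowerSeries.derivative_X,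
    Derivation.map_one_eq_zero, sub_zero, smul_eq_mul, smul_eq_mul] at hD
  have hformal : PowerSeries.derivative ℂ b * ((PowerSeries.exp ℂ - 1) * (PowerSeries.exp ℂ - 1)) =
      (PowerSeries.exp ℂ - 1) - PowerSeries.X * PowerSeries.exp ℂ := by
    rw [← hE]
    linear_combination (PowerSeries.exp ℂ - 1) * hD
  have hG : HasSum (fun n => PowerSeries.coeff n (PowerSeries.derivative ℂ b) * y ^ n)
      (∑' n : ℕ, (bernoulli (n + 1) : ℂ) * y ^ n / n !) := by
    convert hsum.hasSum using 1
    funext n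
    rw [PowerSeries.coeff_derivative]
    simp only [b, bernoulliPowerSeries, PowerSeries.coeff_mk, Nat.factorial_succ]
    have : (n ! : ℂ) ≠ 0 := by exact_mod_cast Nat.factorial_ne_zero n
    have : (n + 1 : ℂ) ≠ 0 := by exact_mod_cast Nat.succ_ne_zero n
    simp only [eq_ratCast]
    push_cast
    field_simp
  have he := hasSum_coeff_sub (hasSum_coeff_exp y) (hasSum_coeff_one y)
  have h1 := hasSum_coeff_mul hG (hasSum_coeff_mul he he)
  have h2 := hasSum_coeff_sub he (hasSum_coeff_mul (hasSum_coeff_X y) (hasSum_coeff_exp y))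
  rw [hformal] at h1
  have h3 := h1.unique h2
  have hne := exp_sub_one_ne_zero h0 (by linarith [Real.pi_gt_three])
  have h4 : (∑' n : ℕ, (bernoulli (n + 1) : ℂ) * y ^ n / n !) = genFactor y := by
    rw [genFactor, if_neg h0, eq_div_iff (pow_ne_zero 2 hne), pow_two, h3]
    ring
  rw [← h4]
  exact hsum.hasSum

/-! ### Families of series -/

/-- Together with `hasSum_fiberwise`, this permits regrouping along a map `p` with finite fibres `F
b`: first exponents by total degree, then arrays of exponents by the monomial they contribute to. -/
theorem summable_norm_of_fiberwise {α β : Type*} {f : α → ℂ} {p : α → β} {F : β → Finset α}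
    (hF : ∀ a b, a ∈ F b ↔ p a = b) (h : Summable fun b => ∑ a ∈ F b, ‖f a‖) :
    Summable fun a => ‖f a‖ := by
  classical
  refine summable_of_sum_le (c := ∑' b, ∑ a ∈ F b, ‖f a‖) (fun a => norm_nonneg _) fun s => ?_
  calc ∑ a ∈ s, ‖f a‖ = ∑ b ∈ s.image p, ∑ a ∈ s with p a = b, ‖f a‖ :=
        (Finset.sum_fiberwise_of_maps_to (fun a ha => Finset.mem_image_of_mem p ha) _).symm
    _ ≤ ∑ b ∈ s.image p, ∑ a ∈ F b, ‖f a‖ := by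
        refine Finset.sum_le_sum fun b _ => Finset.sum_le_sum_of_subset_of_nonneg ?_
          fun _ _ _ => norm_nonneg _
        intro a ha
        exact (hF a b).mpr (Finset.mem_filter.mp ha).2
    _ ≤ _ := h.sum_le_tsum _ fun b _ => Finset.sum_nonneg fun _ _ => norm_nonneg _

theorem hasSum_fiberwise {α β : Type*} {f : α → ℂ} {p : α → β} {F : β → Finset α} {S : ℂ}
    (hF : ∀ a b, a ∈ F b ↔ p a = b) (h : HasSum f S) :
    HasSum (fun b => ∑ a ∈ F b, f a) S := by
  have h1 := (Equiv.sigmaFiberEquiv p).hasSum_iff.mpr h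
  refine h1.sigma fun b => ?_
  have h2 := Finset.hasSum (F b) f
  exact (Equiv.subtypeEquivRight (fun a => hF a b)).hasSum_iff.mp h2

theorem hasSum_mul_prod {α β : Type*} {f : α → ℂ} {g : β → ℂ} {a b : ℂ} (hf : HasSum f a)
    (hg : HasSum g b) : HasSum (fun x : α × β => f x.1 * g x.2) (a * b) :=
  hf.mul hg (summable_mul_of_summable_norm hf.summable.norm hg.summable.norm)

theorem hasSum_prod_family {β : Type*} {r : ℕ} {f : Fin r → β → ℂ} {S : Fin r → ℂ}
    (h : ∀ i, HasSum (f i) (S i)) :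
    HasSum (fun μ : Fin r → β => ∏ i, f i (μ i)) (∏ i, S i) := by
  induction r with
  | zero =>
    simp
  | succ r ih =>
    have h1 := ih (f := fun i => f i.succ) (S := fun i => S i.succ) fun i => h i.succ
    have h2 := hasSum_mul_prod (h 0) h1
    rw [← (Fin.consEquiv fun _ => β).hasSum_iff, Fin.prod_univ_succ]
    convert! h2 using 1
    funext x
    simp [Fin.consEquiv, Fin.prod_univ_succ]

theorem sum_pow_div_factorial {r : ℕ} {K : Type*} [Field K] [CharZero K] (t : Fin r → K) (n : ℕ) :
    (∑ l, t l) ^ n / n ! =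
      ∑ μ ∈ Finset.piAntidiag Finset.univ n, ∏ l, (t l ^ μ l / (μ l)! : K) := by
  rw [Finset.sum_pow_eq_sum_piAntidiag, Finset.sum_div]
  refine Finset.sum_congr rfl fun μ hμ => ?_
  have h := Nat.multinomial_spec Finset.univ μ
  rw [(Finset.mem_piAntidiag.mp hμ).1] at h
  have h' : (∏ i, ((μ i)! : K)) * (Nat.multinomial Finset.univ μ : K) = n ! := by
    exact_mod_cast h
  have hne : (∏ i, ((μ i)! : K)) ≠ 0 :=
    Finset.prod_ne_zero_iff.mpr fun i _ => Nat.cast_ne_zero.mpr (Nat.factorial_ne_zero _)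
  have hne' : (n ! : K) ≠ 0 := Nat.cast_ne_zero.mpr (Nat.factorial_ne_zero _)
  rw [Finset.prod_div_distrib, div_eq_div_iff hne' hne, ← h']
  ring

/-- The multi-indices of degree `n` contribute the `n`-th term by the multinomial theorem. Applied
to the `‖t l‖`, the same theorem turns the hypothesis `hs` into absolute convergence of the
ungrouped series. -/
theorem hasSum_multinomial {r : ℕ} {c : ℕ → ℂ} {t : Fin r → ℂ} {S : ℂ}
    (hs : Summable fun n : ℕ => ‖c n‖ * (∑ l, ‖t l‖) ^ n / n !)
    (hS : HasSum (fun n : ℕ => c n * (∑ l, t l) ^ n / n !) S) :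
    HasSum (fun μ : Fin r → ℕ => c (∑ l, μ l) * ∏ l, (t l ^ μ l / ((μ l)! : ℂ))) S := by
  have hF : ∀ (μ : Fin r → ℕ) (n : ℕ),
      μ ∈ Finset.piAntidiag Finset.univ n ↔ ∑ l, μ l = n := by simp
  have h1 : Summable fun μ : Fin r → ℕ => ‖c (∑ l, μ l) * ∏ l, (t l ^ μ l / ((μ l)! : ℂ))‖ := by
    refine summable_norm_of_fiberwise hF ?_
    convert hs using 2 with n
    rw [mul_div_assoc, sum_pow_div_factorial, Finset.mul_sum]
    refine Finset.sum_congr rfl fun μ hμ => ?_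
    rw [(hF μ n).mp hμ, norm_mul, norm_prod]
    simp
  have h2 := hasSum_fiberwise hF h1.of_norm.hasSum
  have h3 : HasSum (fun n : ℕ => c n * (∑ l, t l) ^ n / n !)
      (∑' μ : Fin r → ℕ, c (∑ l, μ l) * ∏ l, (t l ^ μ l / ((μ l)! : ℂ))) := by
    convert! h2 using 1
    funext n
    rw [mul_div_assoc, sum_pow_div_factorial, Finset.mul_sum]
    refine Finset.sum_congr rfl fun μ hμ => ?_
    rw [(hF μ n).mp hμ]
  rw [hS.unique h3]
  exact h1.of_norm.hasSum

/-! ### The expansion of the generating function -/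

/-- The Taylor coefficients of `∏ⱼ genFactor (y_j)` at the origin. -/
noncomputable def genCoeff {r : ℕ} (γ : Fin r → ℂ) (k : Fin r → ℕ) : ℂ :=
  ∑ ν ∈ nuIndex k,
    ∏ j,
      ((bernoulli (1 + ∑ l ∈ Finset.Ici j, ν l j) : ℂ) *
        γ j ^ (∑ l ∈ Finset.Ici j, ν l j) *
        (1 / ∏ d ∈ Finset.Iic j, ((ν j d)! : ℂ)))

theorem hasSum_genFactor_tailSum {r : ℕ} {γ t : Fin r → ℂ} {j : Fin r}
    (h : ‖γ j‖ * ∑ l, ‖t l‖ < 1) :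
    HasSum (fun μ : Fin r → ℕ => (bernoulli (1 + ∑ l, μ l) : ℂ) * γ j ^ (∑ l, μ l) *
      ∏ l, ((if j ≤ l then t l else 0) ^ μ l / ((μ l)! : ℂ))) (genFactor (tailSum γ t j)) := by
  have hle : ∑ l, ‖if j ≤ l then t l else 0‖ ≤ ∑ l, ‖t l‖ :=
    Finset.sum_le_sum fun l _ => by split_ifs <;> simp
  have hlt : ‖γ j‖ * ∑ l, ‖if j ≤ l then t l else 0‖ < 1 :=
    (mul_le_mul_of_nonneg_left hle (norm_nonneg _)).trans_lt h
  -- Padding the tail sum by zeros lets every factor use exponents in the same set `Fin r → ℕ`;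
  -- exponents that are nonzero at some `l < j` contribute `0`.
  have htail : tailSum γ t j = γ j * ∑ l, if j ≤ l then t l else 0 := by
    rw [tailSum, ← Finset.sum_filter]
    congr 2
    ext; simp
  have hy : ‖tailSum γ t j‖ < 1 := by
    rw [htail, norm_mul]
    exact (mul_le_mul_of_nonneg_left (norm_sum_le _ _) (norm_nonneg _)).trans_lt hlt
  refine hasSum_multinomial (c := fun n => (bernoulli (1 + n) : ℂ) * γ j ^ n) ?_ ?_
  · convert! summable_norm_bernoulli_mul_pow (by positivity) hlt using 2 with n
    rw [norm_mul, norm_pow, mul_pow, add_comm 1 n, mul_assoc]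
  · convert! hasSum_genFactor hy using 2 with n
    rw [htail, mul_pow, add_comm 1 n, mul_assoc]

theorem hasSum_prod_genFactor {r : ℕ} {γ t : Fin r → ℂ} (h : ∀ j, ‖γ j‖ * ∑ l, ‖t l‖ < 1) :
    HasSum (fun m : Fin r → ℕ => genCoeff γ m * ∏ l, t l ^ m l)
      (∏ j, genFactor (tailSum γ t j)) := by
  have h1 := hasSum_prod_family fun j => hasSum_genFactor_tailSum (h j)
  -- Transpose: `ν l j` becomes the exponent of `t l` taken from the `j`-th factor, so the row sums
  -- of `ν` form the total exponent `m`.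
  rw [← (Equiv.piComm fun _ _ : Fin r => ℕ).hasSum_iff] at h1
  have hF : ∀ (ν : Fin r → Fin r → ℕ) (m : Fin r → ℕ),
      ν ∈ Fintype.piFinset (fun j => Finset.piAntidiag Finset.univ (m j)) ↔
        (fun j => ∑ d, ν j d) = m := by
    intro ν m
    simp [Fintype.mem_piFinset, funext_iff]
  convert! hasSum_fiberwise hF h1 using 1
  funext m
  rw [genCoeff, Finset.sum_mul]
  have hsub : nuIndex m ⊆ Fintype.piFinset (fun j => Finset.piAntidiag Finset.univ (m j)) := by
    intro ν hν
    rw [nuIndex, Fintype.mem_piFinset] at hν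
    rw [Fintype.mem_piFinset]
    intro j
    obtain ⟨h1, h2⟩ := Finset.mem_piAntidiag.mp (hν j)
    refine Finset.mem_piAntidiag.mpr ⟨?_, fun _ _ => Finset.mem_univ _⟩
    rw [← h1]
    exact (Finset.sum_subset (Finset.subset_univ _) fun d _ hd => by
      by_contra h; exact hd (h2 d h)).symm
  rw [← Finset.sum_subset hsub]
  · refine Finset.sum_congr rfl fun ν hν => ?_
    have hν' : ∀ j, ∑ d ∈ Finset.Iic j, ν j d = m j ∧ ∀ d, ν j d ≠ 0 → d ∈ Finset.Iic j :=
      fun j => Finset.mem_piAntidiag.mp (Fintype.mem_piFinset.mp hν j)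
    have hz : ∀ j d, j < d → ν j d = 0 := fun j d hd => by
      by_contra h
      exact absurd (Finset.mem_Iic.mp ((hν' j).2 d h)) (not_le.mpr hd)
    have hcol : ∀ d, ∑ l, ν l d = ∑ l ∈ Finset.Ici d, ν l d := fun d =>
      (Finset.sum_subset (Finset.subset_univ _) fun l _ hl =>
        hz l d (by simpa using hl)).symm
    simp only [Function.comp_apply, Equiv.piComm_apply, Function.swap, hcol]
    simp only [Finset.prod_mul_distrib]
    rw [mul_assoc]
    congr 1
    rw [Finset.prod_comm, ← Finset.prod_mul_distrib]
    refine Finset.prod_congr rfl fun l _ => ?_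
    rw [← Finset.prod_subset (Finset.subset_univ (Finset.Iic l))
      fun d _ hd => by rw [hz l d (by simpa using hd)]; simp]
    rw [Finset.prod_div_distrib, ← (hν' l).1, ← Finset.prod_pow_eq_pow_sum, one_div, mul_comm,
      div_eq_mul_inv]
    congr 1
    exact Finset.prod_congr rfl fun d hd => by rw [if_pos (Finset.mem_Iic.mp hd)]
  -- An array outside `nuIndex` has an entry `ν l d ≠ 0` with `l < d`, and the padded zero in the
  -- `d`-th factor kills its term.
  · intro ν hν hν'
    obtain ⟨l, d, hld, hne⟩ : ∃ l d, l < d ∧ ν l d ≠ 0 := by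
      by_contra! hcon
      refine hν' (Fintype.mem_piFinset.mpr fun j => Finset.mem_piAntidiag.mpr ⟨?_, ?_⟩)
      · rw [← (Finset.mem_piAntidiag.mp (Fintype.mem_piFinset.mp hν j)).1]
        exact Finset.sum_subset (Finset.subset_univ _) fun d _ hd =>
          hcon j d (by simpa using hd)
      · intro d hd
        rw [Finset.mem_Iic]
        exact not_lt.mp fun h => hd (hcon j d h)
    refine Finset.prod_eq_zero (Finset.mem_univ d) ?_
    refine mul_eq_zero_of_right _ (Finset.prod_eq_zero (Finset.mem_univ l) ?_)
    simp [not_le.mpr hld, hne, Function.swap]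

/-! ### Bounds for the factors -/

theorem norm_genFactor_le_of_re_ge_one {y : ℂ} (hy : 1 ≤ y.re) :
    ‖genFactor y‖ ≤ 4 * (2 + ‖y‖) * Real.exp (-y.re) := by
  have h0 : y ≠ 0 := by rintro rfl; norm_num at hy
  have hE : ‖Complex.exp y‖ = Real.exp y.re := Complex.norm_exp y
  have h2 : 2 ≤ Real.exp y.re := by linarith [Real.add_one_le_exp y.re]
  have hden : Real.exp y.re / 2 ≤ ‖Complex.exp y - 1‖ := by
    have := norm_sub_norm_le (Complex.exp y) 1
    rw [hE, norm_one] at this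
    linarith
  have hnum : ‖(1 - y) * Complex.exp y - 1‖ ≤ (2 + ‖y‖) * Real.exp y.re := by
    calc ‖(1 - y) * Complex.exp y - 1‖ ≤ ‖1 - y‖ * ‖Complex.exp y‖ + 1 := by
          simpa using norm_sub_le ((1 - y) * Complex.exp y) 1
      _ ≤ (1 + ‖y‖) * Real.exp y.re + 1 * Real.exp y.re := by
          rw [hE]
          gcongr
          · simpa using norm_sub_le 1 y
          · linarith
      _ = _ := by ring
  rw [genFactor, if_neg h0, norm_div, norm_pow]
  have hpos := Real.exp_pos y.re
  calc _ ≤ (2 + ‖y‖) * Real.exp y.re / (Real.exp y.re / 2) ^ 2 := by gcongr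
    _ = _ := by rw [Real.exp_neg]; field_simp; ring

theorem exists_norm_genFactor_le_of_norm_le_half :
    ∃ C, ∀ y : ℂ, ‖y‖ ≤ 1 / 2 → ‖genFactor y‖ ≤ C := by
  have hs := summable_norm_bernoulli_mul_pow (x := 1 / 2) (by norm_num) (by norm_num)
  refine ⟨∑' n : ℕ, ‖(bernoulli (n + 1) : ℂ)‖ * (1 / 2) ^ n / n !, fun y hy => ?_⟩
  refine (hasSum_genFactor (hy.trans_lt (by norm_num))).norm_le_of_bounded hs.hasSum fun n => ?_
  rw [norm_div, norm_mul, norm_pow, Complex.norm_natCast]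
  gcongr

/-- The Bernoulli series bounds `genFactor` near `0`, and continuity of the quotient does so on the
rest of `K`. -/
theorem exists_norm_genFactor_le_of_isCompact {K : Set ℂ} (hK : IsCompact K)
    (hreg : ∀ y ∈ K, y ≠ 0 → Complex.exp y - 1 ≠ 0) : ∃ C, ∀ y ∈ K, ‖genFactor y‖ ≤ C := by
  obtain ⟨C₁, h₁⟩ := exists_norm_genFactor_le_of_norm_le_half
  have hK' : IsCompact (K ∩ {y | 1 / 2 ≤ ‖y‖}) :=
    hK.inter_right (isClosed_le continuous_const continuous_norm)
  have hne : ∀ y ∈ K ∩ {y : ℂ | 1 / 2 ≤ ‖y‖}, y ≠ 0 := by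
    rintro y ⟨-, hy⟩ rfl
    norm_num at hy
  obtain ⟨C₂, h₂⟩ := hK'.exists_bound_of_continuousOn
    (f := fun y => ((1 - y) * Complex.exp y - 1) / (Complex.exp y - 1) ^ 2)
    (ContinuousOn.div (by fun_prop) (by fun_prop)
      fun y hy => pow_ne_zero 2 (hreg y hy.1 (hne y hy)))
  refine ⟨max C₁ C₂, fun y hy => ?_⟩
  rcases le_total ‖y‖ (1 / 2) with h | h
  · exact (h₁ y h).trans (le_max_left _ _)
  · have := h₂ y ⟨hy, h⟩
    rw [genFactor, if_neg (hne y ⟨hy, h⟩)]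
    exact this.trans (le_max_right _ _)

/-- The points `γ (X + W)` fill a thin neighbourhood of the ray `γ [0, ∞)`. Where the real part is
at least `1` the explicit decay applies; the remaining points lie in a compact set without poles. -/
theorem exists_norm_genFactor_le {γ : ℂ} (hγ : 0 < γ.re) :
    ∃ η > 0, ∃ C ≥ 0, ∃ δ > 0, ∀ X : ℝ, 0 ≤ X → ∀ W : ℂ, ‖W‖ ≤ η →
      (γ * (X + W) ≠ 0 → Complex.exp (γ * (X + W)) - 1 ≠ 0) ∧
        ‖genFactor (γ * (X + W))‖ ≤ C * Real.exp (-δ * X) := by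
  have hn : γ.re ≤ ‖γ‖ := Complex.re_le_norm γ
  have hn0 : 0 < ‖γ‖ := hγ.trans_le hn
  -- If `Re (γ (X + W)) ≤ 0` then `X ≤ ‖γ‖ η / Re γ`, so `‖γ (X + W)‖ ≤ ‖γ‖ η (‖γ‖ / Re γ + 1)`.
  -- This `η` makes the last bound `1 < 2π`, which excludes the nonzero zeros of `e^y - 1`.
  set η : ℝ := 1 / (‖γ‖ * (‖γ‖ / γ.re + 1)) with hη
  have hη0 : 0 < η := by positivity
  have hη1 : ‖γ‖ * η * (‖γ‖ / γ.re + 1) = 1 := by rw [hη]; field_simp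
  have hη2 : ‖γ‖ * η ≤ 1 := by
    have : 0 ≤ ‖γ‖ * η * (‖γ‖ / γ.re) := by positivity
    linarith
  have hre : ∀ (X : ℝ) (W : ℂ), ‖W‖ ≤ η → γ.re * X - ‖γ‖ * η ≤ (γ * (X + W)).re := by
    intro X W hW
    have h1 : |(γ * W).re| ≤ ‖γ‖ * η :=
      (Complex.abs_re_le_norm _).trans (by rw [norm_mul]; gcongr)
    have h2 : (γ * (X + W)).re = γ.re * X + (γ * W).re := by
      rw [mul_add, Complex.add_re, Complex.re_mul_ofReal]
    rw [h2]
    linarith [neg_abs_le (γ * W).re]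
  have hnorm : ∀ (X : ℝ) (W : ℂ), 0 ≤ X → ‖W‖ ≤ η → ‖γ * (X + W)‖ ≤ ‖γ‖ * X + ‖γ‖ * η := by
    intro X W hX hW
    rw [norm_mul, ← mul_add]
    gcongr
    refine (norm_add_le _ _).trans ?_
    rw [Complex.norm_real, Real.norm_of_nonneg hX]
    gcongr
  have hreg : ∀ (X : ℝ) (W : ℂ), 0 ≤ X → ‖W‖ ≤ η →
      (γ * (X + W) ≠ 0 → Complex.exp (γ * (X + W)) - 1 ≠ 0) := by
    intro X W hX hW h0
    rcases lt_or_ge 0 (γ * (X + W)).re with hpos | hneg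
    · intro he
      have h1 := Complex.norm_exp (γ * (X + W))
      rw [sub_eq_zero.mp he, norm_one] at h1
      linarith [Real.add_one_lt_exp hpos.ne']
    · refine exp_sub_one_ne_zero h0 ?_
      have hX' : X ≤ ‖γ‖ * η / γ.re := by
        rw [le_div_iff₀ hγ]; linarith [hre X W hW]
      calc _ ≤ ‖γ‖ * X + ‖γ‖ * η := hnorm X W hX hW
        _ ≤ ‖γ‖ * (‖γ‖ * η / γ.re) + ‖γ‖ * η := by gcongr
        _ = 1 := by rw [← hη1]; ring
        _ < _ := by linarith [Real.pi_gt_three]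
  -- Real part at most `1` forces `Re γ * X ≤ 1 + ‖γ‖ η ≤ 2`.
  set M : ℝ := 2 / γ.re
  have hK : IsCompact ((fun p : ℝ × ℂ => γ * (p.1 + p.2)) ''
      (Set.Icc 0 M ×ˢ Metric.closedBall 0 η)) :=
    (isCompact_Icc.prod (isCompact_closedBall 0 η)).image (by fun_prop)
  obtain ⟨C₁, hC₁⟩ := exists_norm_genFactor_le_of_isCompact hK (by
    rintro _ ⟨⟨X, W⟩, ⟨hX, hW⟩, rfl⟩
    exact hreg X W hX.1 (by simpa using hW))
  -- Half of the decay rate `Re γ` is kept; the other half absorbs the linear factor `2 + ‖y‖`.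
  set δ : ℝ := γ.re / 2 with hδ
  have hδ0 : 0 < δ := by positivity
  set C₂ : ℝ := 4 * Real.exp 1 * (3 + ‖γ‖ / δ) with hC₂
  refine ⟨η, hη0, max C₂ (|C₁| * Real.exp (δ * M)), by positivity, δ, hδ0,
    fun X hX W hW => ⟨hreg X W hX hW, ?_⟩⟩
  rcases le_total 1 (γ * (X + W)).re with h | h
  · refine (norm_genFactor_le_of_re_ge_one h).trans
      (le_trans ?_ (mul_le_mul_of_nonneg_right (le_max_left _ _) (Real.exp_pos _).le))
    have e1 : Real.exp (-(γ * (X + W)).re) ≤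
        Real.exp 1 * Real.exp (-δ * X) * Real.exp (-δ * X) := by
      rw [← Real.exp_add, ← Real.exp_add]
      refine Real.exp_le_exp.mpr ?_
      have := hre X W hW
      rw [hδ]; linarith
    have e2 : ‖γ * (X + W)‖ ≤ ‖γ‖ * X + 1 := (hnorm X W hX hW).trans (by linarith)
    have e3 : 2 + ‖γ * (X + W)‖ ≤ (3 + ‖γ‖ / δ) * Real.exp (δ * X) := by
      have f1 := Real.add_one_le_exp (δ * X)
      have f2 : 0 ≤ δ * X := by positivity
      have f3 : ‖γ‖ * X ≤ ‖γ‖ / δ * Real.exp (δ * X) := by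
        calc ‖γ‖ * X = ‖γ‖ / δ * (δ * X) := by field_simp
          _ ≤ _ := by gcongr; linarith
      linarith
    calc _ ≤ 4 * ((3 + ‖γ‖ / δ) * Real.exp (δ * X)) *
          (Real.exp 1 * Real.exp (-δ * X) * Real.exp (-δ * X)) := by gcongr
      _ = C₂ * Real.exp (-δ * X) * (Real.exp (δ * X) * Real.exp (-δ * X)) := by rw [hC₂]; ring
      _ = _ := by rw [← Real.exp_add]; simp
  · have hX' : X ≤ M := by
      rw [le_div_iff₀ hγ]; linarith [hre X W hW]
    have h1 := hC₁ _ ⟨(X, W), ⟨⟨hX, hX'⟩, by simpa using hW⟩, rfl⟩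
    calc _ ≤ |C₁| * 1 := by rw [mul_one]; exact h1.trans (le_abs_self _)
      _ ≤ |C₁| * (Real.exp (δ * M) * Real.exp (-δ * X)) := by
          gcongr
          rw [← Real.exp_add]
          refine Real.one_le_exp ?_
          nlinarith
      _ ≤ _ := by
          rw [← mul_assoc]
          gcongr
          exact le_max_right _ _

theorem hasDerivAt_div_exp_sub_one {y : ℂ} {x : ℝ} (h0 : x * y ≠ 0)
    (h : Complex.exp (x * y) - 1 ≠ 0) :
    HasDerivAt (fun x : ℝ => (x : ℂ) / (Complex.exp (x * y) - 1)) (genFactor (x * y)) x := by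
  have h1 : HasDerivAt (fun z : ℂ => z / (Complex.exp (z * y) - 1)) (genFactor (x * y)) (x : ℂ) := by
    have h2 := ((((hasDerivAt_id (x : ℂ)).mul_const y).cexp).sub_const 1)
    refine ((hasDerivAt_id (x : ℂ)).div h2 h).congr_deriv ?_
    rw [genFactor, if_neg h0]
    simp only [id]
    ring
  exact h1.comp_ofReal

/-- Mean value inequality for `x ↦ x / (e^(xy) - 1)` between `1` and `c`. At `y = 0` the bound holds
because `genFactor 0 = -1/2` forces `B ≥ 1/2`. -/
theorem norm_regFactor_le {c B : ℝ} {y : ℂ} (hc : 0 < c)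
    (hreg : ∀ x ∈ Set.uIcc 1 c, (x * y : ℂ) ≠ 0 → Complex.exp (x * y) - 1 ≠ 0)
    (hB : ∀ x ∈ Set.uIcc 1 c, ‖genFactor (x * y)‖ ≤ B) :
    ‖regFactor c y‖ ≤ B * |c - 1| := by
  rcases eq_or_ne y 0 with rfl | hy
  · have h := hB 1 Set.left_mem_uIcc
    simp only [genFactor, mul_zero, if_true] at h
    norm_num at h
    rw [regFactor, if_pos rfl, norm_div, ← Complex.ofReal_one, ← Complex.ofReal_sub,
      Complex.norm_real, Real.norm_eq_abs, Complex.norm_ofNat]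
    nlinarith [abs_nonneg (c - 1)]
  · have hx : ∀ x ∈ Set.uIcc 1 c, (x * y : ℂ) ≠ 0 := by
      intro x hx
      have : 0 < x := lt_of_lt_of_le (lt_min one_pos hc) hx.1
      exact mul_ne_zero (by exact_mod_cast this.ne') hy
    have h := (convex_uIcc (1 : ℝ) c).norm_image_sub_le_of_norm_hasDerivWithin_le
      (fun x hx' => (hasDerivAt_div_exp_sub_one (hx x hx') (hreg x hx' (hx x hx'))).hasDerivWithinAt)
      hB Set.left_mem_uIcc Set.right_mem_uIcc
    rw [← norm_neg, neg_sub] at h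
    simpa [regFactor, hy] using h

theorem tendsto_regFactor_div {y : ℂ} (h : y ≠ 0 → Complex.exp y - 1 ≠ 0) :
    Tendsto (fun c : ℝ => regFactor c y / ((c : ℂ) - 1)) (𝓝[≠] 1) (𝓝 (-genFactor y)) := by
  have hc : ∀ c : ℝ, c ≠ 1 → (c : ℂ) - 1 ≠ 0 := fun c h => sub_ne_zero.mpr (by exact_mod_cast h)
  rcases eq_or_ne y 0 with rfl | hy
  · refine tendsto_const_nhds.congr' ?_
    filter_upwards [self_mem_nhdsWithin] with c h
    rw [regFactor, if_pos rfl, genFactor, if_pos rfl]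
    have := hc c h
    field_simp
  · have h1 := hasDerivAt_div_exp_sub_one (y := y) (x := 1) (by simpa using hy) (by simpa using h hy)
    have h2 := (hasDerivAt_iff_tendsto_slope.mp h1).neg
    simp only [Complex.ofReal_one, one_mul] at h2
    refine h2.congr' ?_
    filter_upwards [self_mem_nhdsWithin] with c h
    rw [regFactor, if_neg hy, slope_def_module, Complex.real_smul]
    push_cast
    have := hc c h
    rw [one_mul]
    field_simp
    ring

theorem exists_norm_regFactor_le {γ : ℂ} (hγ : 0 < γ.re) :
    ∃ η > 0, ∃ C ≥ 0, ∃ δ > 0, ∀ X : ℝ, 0 ≤ X → ∀ W : ℂ, ‖W‖ ≤ η →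
      (γ * (X + W) ≠ 0 → Complex.exp (γ * (X + W)) - 1 ≠ 0) ∧
      ‖genFactor (γ * (X + W))‖ ≤ C * Real.exp (-δ * X) ∧
      ∀ c ∈ Set.Icc (1 / 2 : ℝ) (3 / 2),
        ‖regFactor c (γ * (X + W))‖ ≤ C * Real.exp (-δ * X) * |c - 1| := by
  obtain ⟨η, hη, C, hC, δ, hδ, h⟩ := exists_norm_genFactor_le hγ
  have key : ∀ X : ℝ, 0 ≤ X → ∀ W : ℂ, ‖W‖ ≤ η / 2 → ∀ x ∈ Set.Icc (1 / 2 : ℝ) (3 / 2),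
      ((x * (γ * (X + W)) : ℂ) ≠ 0 → Complex.exp (x * (γ * (X + W))) - 1 ≠ 0) ∧
      ‖genFactor (x * (γ * (X + W)))‖ ≤ C * Real.exp (-(δ / 2) * X) := by
    intro X hX W hW x hx
    have hx0 : 0 ≤ x := by linarith [hx.1]
    -- Scaling by `x ∈ [1/2, 3/2]` stays in the controlled region because `‖W‖ ≤ η / 2`; since `x *
    -- X ≥ X / 2`, the rate is halved.
    have e : (x * (γ * (X + W)) : ℂ) = γ * ((x * X : ℝ) + x * W) := by push_cast; ring
    have h1 := h (x * X) (by positivity) (x * W) (by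
      rw [norm_mul, Complex.norm_real, Real.norm_of_nonneg hx0]
      nlinarith [hx.2, norm_nonneg W])
    rw [e]
    refine ⟨h1.1, h1.2.trans ?_⟩
    refine mul_le_mul_of_nonneg_left (Real.exp_le_exp.mpr ?_) hC
    have := hx.1
    nlinarith [mul_nonneg hδ.le hX]
  refine ⟨η / 2, by positivity, C, hC, δ / 2, by positivity, fun X hX W hW => ?_⟩
  have h1 := key X hX W hW 1 (by norm_num)
  rw [Complex.ofReal_one, one_mul] at h1
  refine ⟨h1.1, h1.2, fun c hc => ?_⟩
  have hsub : Set.uIcc 1 c ⊆ Set.Icc (1 / 2 : ℝ) (3 / 2) :=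
    Set.uIcc_subset_Icc (by norm_num) hc
  exact norm_regFactor_le (by linarith [hc.1]) (fun x hx => (key X hX W hW x (hsub hx)).1)
    (fun x hx => (key X hX W hW x (hsub hx)).2)

/-! ### Geometry of the Hankel contour -/

theorem le_hankelRadius (ε u : ℝ) : ε ≤ hankelRadius ε u := by
  have h1 := le_max_left 0 (-u)
  have h2 := le_max_left 0 (u - 2 * Real.pi)
  rw [hankelRadius]; linarith

/-- Either the point is on the circle and the excess radius is `0`, or it is on a ray and the phase
is `1`. -/
theorem hankelPath_eq_add (ε u : ℝ) :
    hankelPath ε u = ((hankelRadius ε u - ε : ℝ) : ℂ) + ε * Complex.exp (hankelArg u * Complex.I) := by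
  have hpi := Real.pi_pos
  have key : (hankelRadius ε u - ε : ℝ) = 0 ∨ Complex.exp (hankelArg u * Complex.I) = 1 := by
    rcases lt_or_ge u 0 with h | h
    · right
      rw [hankelArg, min_eq_left (by linarith), max_eq_left h.le]
      simp
    · rcases le_or_gt u (2 * Real.pi) with h' | h'
      · left
        rw [hankelRadius, max_eq_left (by linarith), max_eq_left (by linarith)]
        ring
      · right
        rw [hankelArg, min_eq_right h'.le, max_eq_right (by linarith)]
        push_cast
        exact Complex.exp_two_pi_mul_I
  rw [hankelPath]
  rcases key with h | h
  · rw [h, sub_eq_zero.mp h]; simp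
  · rw [h]; push_cast; ring

/-- The tail sum includes `t_j` itself and all excess radii are non-negative, so `X` is at least the
excess of `t_j`. This is what makes the `j`-th factor decay in the `j`-th variable. -/
theorem tailSum_hankelPath {r : ℕ} (γ : Fin r → ℂ) {ε : ℝ} (hε : 0 ≤ ε) (u : Fin r → ℝ)
    (j : Fin r) :
    ∃ X : ℝ, hankelRadius ε (u j) - ε ≤ X ∧ ∃ W : ℂ, ‖W‖ ≤ r * ε ∧
      tailSum γ (fun k => hankelPath ε (u k)) j = γ j * (X + W) := by
  refine ⟨∑ k ∈ Finset.Ici j, (hankelRadius ε (u k) - ε), ?_,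
    ∑ k ∈ Finset.Ici j, ε * Complex.exp (hankelArg (u k) * Complex.I), ?_, ?_⟩
  · exact Finset.single_le_sum (f := fun k => hankelRadius ε (u k) - ε)
      (fun k _ => sub_nonneg.mpr (le_hankelRadius ε (u k))) (Finset.mem_Ici.mpr le_rfl)
  · calc _ ≤ ∑ k ∈ Finset.Ici j, ε := by
          refine norm_sum_le_of_le _ fun k _ => ?_
          rw [norm_mul, Complex.norm_exp_ofReal_mul_I, Complex.norm_real, Real.norm_of_nonneg hε,
            mul_one]
      _ ≤ ∑ k : Fin r, ε := Finset.sum_le_sum_of_subset_of_nonneg (Finset.subset_univ _)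
          fun _ _ _ => hε
      _ = r * ε := by simp
  · rw [tailSum, Complex.ofReal_sum, ← Finset.sum_add_distrib]
    simp only [hankelPath_eq_add]

theorem eventually_contour_bounds {r : ℕ} {γ : Fin r → ℂ} (hγ : ∀ j, 0 < (γ j).re) :
    ∃ C δ : Fin r → ℝ, (∀ j, 0 ≤ C j) ∧ (∀ j, 0 < δ j) ∧ ∀ᶠ ε : ℝ in 𝓝[>] 0,
      ∀ (j : Fin r) (u : Fin r → ℝ),
        (tailSum γ (fun k => hankelPath ε (u k)) j ≠ 0 →
          Complex.exp (tailSum γ (fun k => hankelPath ε (u k)) j) - 1 ≠ 0) ∧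
        ‖genFactor (tailSum γ (fun k => hankelPath ε (u k)) j)‖ ≤
          C j * Real.exp (-δ j * (hankelRadius ε (u j) - ε)) ∧
        ∀ c ∈ Set.Icc (1 / 2 : ℝ) (3 / 2),
          ‖regFactor c (tailSum γ (fun k => hankelPath ε (u k)) j)‖ ≤
            C j * Real.exp (-δ j * (hankelRadius ε (u j) - ε)) * |c - 1| := by
  choose η hη C hC δ hδ h using fun j => exists_norm_regFactor_le (hγ j)
  refine ⟨C, δ, hC, hδ, eventually_all.mpr fun j => ?_⟩
  have hsmall : ∀ᶠ ε : ℝ in 𝓝[>] 0, r * ε < η j := by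
    have : Tendsto (fun ε : ℝ => r * ε) (𝓝[>] 0) (𝓝 (r * 0)) :=
      ((continuous_const_mul (r : ℝ)).tendsto 0).mono_left nhdsWithin_le_nhds
    rw [mul_zero] at this
    exact this.eventually_lt_const (hη j)
  filter_upwards [hsmall, self_mem_nhdsWithin] with ε hε hpos u
  have hpos : 0 < ε := hpos
  obtain ⟨X, hX, W, hW, he⟩ := tailSum_hankelPath γ hpos.le u j
  have hX0 : 0 ≤ X := (sub_nonneg.mpr (le_hankelRadius ε (u j))).trans hX
  have h1 := h j X hX0 W (hW.trans hε.le)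
  have hexp : C j * Real.exp (-δ j * X) ≤
      C j * Real.exp (-δ j * (hankelRadius ε (u j) - ε)) := by
    refine mul_le_mul_of_nonneg_left (Real.exp_le_exp.mpr ?_) (hC j)
    nlinarith [hδ j]
  rw [he]
  exact ⟨h1.1, h1.2.1.trans hexp, fun c hc =>
    (h1.2.2 c hc).trans (mul_le_mul_of_nonneg_right hexp (abs_nonneg _))⟩

/-! ### Measurability and derivatives along the contour -/

theorem continuous_hankelRadius (ε : ℝ) : Continuous (hankelRadius ε) := by
  unfold hankelRadius; fun_prop

theorem continuous_hankelArg : Continuous hankelArg := by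
  unfold hankelArg; fun_prop

theorem continuous_hankelPath (ε : ℝ) : Continuous (hankelPath ε) := by
  have h1 := continuous_hankelRadius ε
  have h2 := continuous_hankelArg
  unfold hankelPath; fun_prop

theorem measurable_hankelLog (ε : ℝ) : Measurable (hankelLog ε) := by
  have h1 := (continuous_hankelRadius ε).measurable
  have h2 := continuous_hankelArg.measurable
  unfold hankelLog; fun_prop

theorem measurable_regFactor (c : ℝ) : Measurable (regFactor c) :=
  Measurable.ite (measurableSet_singleton 0) measurable_const (by fun_prop)

theorem measurable_genFactor : Measurable genFactor :=
  Measurable.ite (measurableSet_singleton 0) measurable_const (by fun_prop)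

theorem continuous_tailSum {r : ℕ} (γ : Fin r → ℂ) (j : Fin r) :
    Continuous fun t => tailSum γ t j := by
  unfold tailSum; fun_prop

theorem measurable_regProduct {r : ℕ} (γ : Fin r → ℂ) (c : ℝ) : Measurable (regProduct γ c) :=
  Finset.measurable_prod _ fun j _ =>
    (measurable_regFactor c).comp (continuous_tailSum γ j).measurable

/-- The generating function `∏ⱼ ((1 - y_j) e^(y_j) - 1) / (e^(y_j) - 1)^2`. -/
noncomputable def genProduct {r : ℕ} (γ : Fin r → ℂ) (t : Fin r → ℂ) : ℂ :=
  ∏ j, genFactor (tailSum γ t j)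

theorem measurable_genProduct {r : ℕ} (γ : Fin r → ℂ) : Measurable (genProduct γ) :=
  Finset.measurable_prod _ fun j _ => measurable_genFactor.comp (continuous_tailSum γ j).measurable

theorem measurable_hankelIntegrand {r : ℕ} (ε : ℝ) {G : (Fin r → ℂ) → ℂ} (hG : Measurable G)
    (s : Fin r → ℂ) : Measurable (hankelIntegrand ε G s) := by
  have h1 := (continuous_hankelPath ε).measurable
  have h2 := measurable_hankelLog ε
  have h3 : Measurable (deriv (hankelPath ε)) := measurable_deriv _
  unfold hankelIntegrand
  refine (hG.comp (by fun_prop)).mul (Finset.measurable_prod _ fun k _ => ?_)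
  fun_prop

theorem hankelPath_of_nonpos {ε u : ℝ} (h : u ≤ 0) : hankelPath ε u = ε - u := by
  have hpi := Real.pi_pos
  rw [hankelPath, hankelRadius, hankelArg, min_eq_left (by linarith), max_eq_left h,
    max_eq_right (by linarith), max_eq_left (by linarith)]
  simp [sub_eq_add_neg]

theorem hankelPath_of_mem_Icc {ε u : ℝ} (h : u ∈ Set.Icc 0 (2 * Real.pi)) :
    hankelPath ε u = ε * Complex.exp (u * Complex.I) := by
  rw [hankelPath, hankelRadius, hankelArg, min_eq_left h.2, max_eq_right h.1,
    max_eq_left (by linarith [h.1]), max_eq_left (by linarith [h.2])]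
  simp

theorem hankelPath_two_pi_sub {ε u : ℝ} (h : u ∉ Set.Icc 0 (2 * Real.pi)) :
    hankelPath ε (2 * Real.pi - u) = hankelPath ε u := by
  have hpi := Real.pi_pos
  have key : ∀ u : ℝ, u < 0 → hankelPath ε (2 * Real.pi - u) = hankelPath ε u := by
    intro u hu
    rw [hankelPath_of_nonpos hu.le, hankelPath, hankelRadius, hankelArg,
      min_eq_right (by linarith), max_eq_left (by linarith), max_eq_right (by linarith),
      max_eq_right (by linarith)]
    push_cast
    rw [Complex.exp_two_pi_mul_I]
    ring
  rw [Set.mem_Icc, not_and_or, not_le, not_le] at h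
  rcases h with h | h
  · exact key u h
  · have := key (2 * Real.pi - u) (by linarith)
    rw [sub_sub_cancel] at this
    exact this.symm

theorem deriv_hankelPath_of_neg {ε u : ℝ} (h : u < 0) : deriv (hankelPath ε) u = -1 := by
  have h1 : hankelPath ε =ᶠ[𝓝 u] fun u => (ε : ℂ) - (u : ℂ) := by
    filter_upwards [Iio_mem_nhds h] with v hv
    exact hankelPath_of_nonpos (le_of_lt hv)
  rw [h1.deriv_eq]
  exact (Complex.ofRealCLM.hasDerivAt.const_sub (ε : ℂ)).deriv

theorem deriv_hankelPath_of_mem_Ioo {ε u : ℝ} (h : u ∈ Set.Ioo 0 (2 * Real.pi)) :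
    deriv (hankelPath ε) u = ε * (Complex.exp (u * Complex.I) * Complex.I) := by
  have h1 : hankelPath ε =ᶠ[𝓝 u] fun u => (ε : ℂ) * Complex.exp (u * Complex.I) := by
    filter_upwards [Ioo_mem_nhds h.1 h.2] with v hv
    exact hankelPath_of_mem_Icc ⟨hv.1.le, hv.2.le⟩
  rw [h1.deriv_eq]
  have h2 := ((Complex.ofRealCLM.hasDerivAt (x := u)).mul_const Complex.I).cexp.const_mul (ε : ℂ)
  simpa using h2.deriv

theorem deriv_hankelPath_two_pi_sub {ε u : ℝ} (h : u ∉ Set.Icc 0 (2 * Real.pi)) :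
    deriv (hankelPath ε) (2 * Real.pi - u) = -deriv (hankelPath ε) u := by
  have h1 : (fun v => hankelPath ε (2 * Real.pi - v)) =ᶠ[𝓝 u] hankelPath ε := by
    filter_upwards [isClosed_Icc.isOpen_compl.mem_nhds h] with v hv
    exact hankelPath_two_pi_sub hv
  rw [← h1.deriv_eq, deriv_comp_const_sub, neg_neg]

theorem ae_norm_deriv_hankelPath_le {ε : ℝ} (hε : 0 ≤ ε) :
    ∀ᵐ u : ℝ, ‖deriv (hankelPath ε) u‖ ≤ max 1 ε := by
  -- The parameters `0` and `2π`, where the rays meet the circle, form a null set.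
  have h0 : ∀ᵐ u : ℝ, u ≠ 0 := Measure.ae_ne volume 0
  have h1 : ∀ᵐ u : ℝ, u ≠ 2 * Real.pi := Measure.ae_ne volume _
  filter_upwards [h0, h1] with u h0 h1
  have hneg : ∀ u : ℝ, u < 0 → ‖deriv (hankelPath ε) u‖ ≤ max 1 ε := by
    intro u hu
    rw [deriv_hankelPath_of_neg hu]
    simp
  rcases lt_or_gt_of_ne h0 with h | h
  · exact hneg u h
  · rcases lt_or_gt_of_ne h1 with h' | h'
    · rw [deriv_hankelPath_of_mem_Ioo ⟨h, h'⟩]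
      simp only [norm_mul, Complex.norm_real, Complex.norm_exp_ofReal_mul_I, Complex.norm_I,
        Real.norm_of_nonneg hε, mul_one]
      exact le_max_right _ _
    · have := hneg (2 * Real.pi - u) (by linarith)
      rwa [deriv_hankelPath_two_pi_sub (fun hu => absurd hu.2 (not_le.mpr h')), norm_neg] at this

/-! ### An integrable majorant -/

/-- A bound for one coordinate of the integrand, for exponents with `|s - 1| ≤ A`. -/
noncomputable def hankelMajorant (ε A C δ u : ℝ) : ℝ :=
  C * Real.exp (-δ * (hankelRadius ε u - ε)) *
    (Real.exp (A * (|Real.log (hankelRadius ε u)| + 2 * Real.pi)) * max 1 ε)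

theorem integrable_exp_neg_mul_abs {a : ℝ} (ha : 0 < a) :
    Integrable fun u : ℝ => Real.exp (-a * |u|) := by
  rw [← integrableOn_univ, ← Set.Iic_union_Ioi (a := (0 : ℝ))]
  refine IntegrableOn.union ?_ ?_
  · refine (integrableOn_exp_mul_Iic ha 0).congr_fun (fun u hu => ?_) measurableSet_Iic
    rw [abs_of_nonpos hu]; ring_nf
  · refine (integrableOn_exp_mul_Ioi (neg_lt_zero.mpr ha) 0).congr_fun (fun u hu => ?_)
      measurableSet_Ioi
    rw [abs_of_pos hu]

/-- The slope `τ` is free, so that the growth of `|t^(s-1)|` can be made slower than any given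
exponential decay. -/
theorem abs_log_le {x ε τ : ℝ} (hε : 0 < ε) (hx : ε ≤ x) (hτ : 0 < τ) :
    |Real.log x| ≤ τ * x + |Real.log τ| + |Real.log ε| := by
  have hx0 : 0 < x := hε.trans_le hx
  rw [abs_le]
  constructor
  · have h1 := Real.log_le_log hε hx
    have h2 := neg_abs_le (Real.log ε)
    have h3 := abs_nonneg (Real.log τ)
    have h4 : 0 ≤ τ * x := by positivity
    linarith
  · have h1 := Real.log_le_sub_one_of_pos (mul_pos hτ hx0)
    rw [Real.log_mul hτ.ne' hx0.ne'] at h1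
    have h2 := neg_abs_le (Real.log τ)
    have h3 := abs_nonneg (Real.log ε)
    linarith

theorem abs_sub_two_pi_le_hankelRadius {ε : ℝ} (hε : 0 ≤ ε) (u : ℝ) :
    |u| - 2 * Real.pi ≤ hankelRadius ε u := by
  have hpi := Real.pi_pos
  have h1 := le_max_left 0 (-u)
  have h2 := le_max_left 0 (u - 2 * Real.pi)
  have h3 := le_max_right 0 (-u)
  have h4 := le_max_right 0 (u - 2 * Real.pi)
  rw [hankelRadius]
  rcases abs_cases u with ⟨h, -⟩ | ⟨h, -⟩ <;> linarith

theorem integrable_hankelMajorant {ε A C δ : ℝ} (hε : 0 < ε) (hA : 0 ≤ A) (hC : 0 ≤ C)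
    (hδ : 0 < δ) : Integrable (hankelMajorant ε A C δ) := by
  -- This gives `A * τ ≤ δ / 2`, so half of the decay survives; `A + 1` avoids division by zero.
  set τ : ℝ := δ / (2 * (A + 1)) with hτ
  have hτ0 : 0 < τ := by positivity
  have hτA : A * τ ≤ δ / 2 := by
    rw [hτ, mul_div_assoc', div_le_div_iff₀ (by positivity) (by positivity)]
    nlinarith
  set K : ℝ := C * max 1 ε *
    Real.exp (δ * ε + A * (|Real.log τ| + |Real.log ε| + 2 * Real.pi) + δ / 2 * (2 * Real.pi))
  refine ((integrable_exp_neg_mul_abs (half_pos hδ)).const_mul K).mono' ?_ (ae_of_all _ fun u => ?_)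
  · have h1 := (continuous_hankelRadius ε).measurable
    refine Measurable.aestronglyMeasurable ?_
    unfold hankelMajorant
    fun_prop
  · have hpos : 0 ≤ hankelMajorant ε A C δ u := by unfold hankelMajorant; positivity
    rw [Real.norm_of_nonneg hpos, hankelMajorant]
    calc _ = C * max 1 ε * Real.exp (-δ * (hankelRadius ε u - ε) +
          A * (|Real.log (hankelRadius ε u)| + 2 * Real.pi)) := by rw [Real.exp_add]; ring
      _ ≤ C * max 1 ε * Real.exp (δ * ε + A * (|Real.log τ| + |Real.log ε| + 2 * Real.pi) +
          δ / 2 * (2 * Real.pi) + -(δ / 2) * |u|) := by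
          refine mul_le_mul_of_nonneg_left (Real.exp_le_exp.mpr ?_) (by positivity)
          have h1 := mul_le_mul_of_nonneg_left (abs_log_le hε (le_hankelRadius ε u) hτ0) hA
          have h2 := abs_sub_two_pi_le_hankelRadius hε.le u
          have h3 : A * τ * hankelRadius ε u ≤ δ / 2 * hankelRadius ε u :=
            mul_le_mul_of_nonneg_right hτA (hε.le.trans (le_hankelRadius ε u))
          have h4 := mul_le_mul_of_nonneg_left h2 (half_pos hδ).le
          nlinarith
      _ = _ := by rw [Real.exp_add]; ring

theorem norm_hankelLog_le (ε u : ℝ) :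
    ‖hankelLog ε u‖ ≤ |Real.log (hankelRadius ε u)| + 2 * Real.pi := by
  have hpi := Real.pi_pos
  rw [hankelLog]
  refine (norm_add_le _ _).trans (add_le_add ?_ ?_)
  · rw [Complex.norm_real, Real.norm_eq_abs]
  · rw [norm_mul, Complex.norm_I, mul_one, Complex.norm_real, hankelArg,
      Real.norm_of_nonneg (le_max_left _ _)]
    exact max_le (by positivity) (min_le_right _ _)

theorem ae_norm_hankelIntegrand_le {r : ℕ} {ε A B : ℝ} {C δ : Fin r → ℝ} {G : (Fin r → ℂ) → ℂ}
    {s : Fin r → ℂ} (hε : 0 ≤ ε) (hB : 0 ≤ B) (hC : ∀ j, 0 ≤ C j) (hs : ∀ k, ‖s k - 1‖ ≤ A)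
    (hG : ∀ u : Fin r → ℝ, ‖G fun k => hankelPath ε (u k)‖ ≤
      B * ∏ j, (C j * Real.exp (-δ j * (hankelRadius ε (u j) - ε)))) :
    ∀ᵐ u : Fin r → ℝ,
      ‖hankelIntegrand ε G s u‖ ≤ B * ∏ j, hankelMajorant ε A (C j) (δ j) (u j) := by
  have hd : ∀ᵐ u : Fin r → ℝ, ∀ k, ‖deriv (hankelPath ε) (u k)‖ ≤ max 1 ε :=
    ae_all_iff.mpr fun k =>
      (Measure.tendsto_eval_ae_ae (μ := fun _ : Fin r => (volume : Measure ℝ)) (i := k)).eventually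
        (ae_norm_deriv_hankelPath_le hε)
  filter_upwards [hd] with u hu
  rw [show ∏ j, hankelMajorant ε A (C j) (δ j) (u j) = _ from Finset.prod_mul_distrib,
    hankelIntegrand, norm_mul, ← mul_assoc]
  refine mul_le_mul ?_ ?_ (norm_nonneg _) (mul_nonneg hB (Finset.prod_nonneg fun j _ =>
    mul_nonneg (hC j) (Real.exp_pos _).le))
  · exact hG u
  · rw [norm_prod]
    refine Finset.prod_le_prod (fun _ _ => norm_nonneg _) fun k _ => ?_
    rw [norm_mul]
    refine mul_le_mul ?_ (hu k) (norm_nonneg _) (Real.exp_pos _).le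
    refine (Complex.norm_exp_le_exp_norm _).trans (Real.exp_le_exp.mpr ?_)
    rw [norm_mul]
    exact mul_le_mul (hs k) (norm_hankelLog_le ε (u k)) (norm_nonneg _)
      ((norm_nonneg _).trans (hs k))

theorem integrable_prod_hankelMajorant {r : ℕ} {ε A : ℝ} {C δ : Fin r → ℝ} (hε : 0 < ε)
    (hA : 0 ≤ A) (hC : ∀ j, 0 ≤ C j) (hδ : ∀ j, 0 < δ j) (B : ℝ) :
    Integrable fun u : Fin r → ℝ => B * ∏ j, hankelMajorant ε A (C j) (δ j) (u j) :=
  (Integrable.fintype_prod fun j => integrable_hankelMajorant hε hA (hC j) (hδ j)).const_mul B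

theorem exists_norm_sub_one_le {r : ℕ} (s : Fin r → ℂ) : ∃ A ≥ 0, ∀ k, ‖s k - 1‖ ≤ A :=
  ⟨‖fun k => s k - 1‖, norm_nonneg _, fun k => norm_le_pi_norm (fun k => s k - 1) k⟩

/-! ### The limit `c → 1` and the continuity in `s` -/

/-- The radius `ε` is small enough for the bounds of `eventually_contour_bounds`. -/
structure IsAdmissible {r : ℕ} (γ : Fin r → ℂ) (C δ : Fin r → ℝ) (ε : ℝ) : Prop where
  pos : 0 < ε
  const_nonneg : ∀ j, 0 ≤ C j
  rate_pos : ∀ j, 0 < δ j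
  exp_sub_one_ne_zero : ∀ (j : Fin r) (u : Fin r → ℝ),
    tailSum γ (fun k => hankelPath ε (u k)) j ≠ 0 →
      Complex.exp (tailSum γ (fun k => hankelPath ε (u k)) j) - 1 ≠ 0
  norm_genFactor_le : ∀ (j : Fin r) (u : Fin r → ℝ),
    ‖genFactor (tailSum γ (fun k => hankelPath ε (u k)) j)‖ ≤
      C j * Real.exp (-δ j * (hankelRadius ε (u j) - ε))
  norm_regFactor_le : ∀ (j : Fin r) (u : Fin r → ℝ), ∀ c ∈ Set.Icc (1 / 2 : ℝ) (3 / 2),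
    ‖regFactor c (tailSum γ (fun k => hankelPath ε (u k)) j)‖ ≤
      C j * Real.exp (-δ j * (hankelRadius ε (u j) - ε)) * |c - 1|
  -- This puts the product of circles `|t_k| = ε` inside the region where the Taylor series of
  -- `genProduct` converges absolutely.
  radius_small : ∀ j, ‖γ j‖ * (r * ε) < 1

theorem eventually_isAdmissible {r : ℕ} {γ : Fin r → ℂ} (hγ : ∀ j, 0 < (γ j).re) :
    ∃ C δ : Fin r → ℝ, ∀ᶠ ε : ℝ in 𝓝[>] 0, IsAdmissible γ C δ ε := by
  obtain ⟨C, δ, hC, hδ, h⟩ := eventually_contour_bounds hγ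
  refine ⟨C, δ, ?_⟩
  have hsmall : ∀ᶠ ε : ℝ in 𝓝[>] 0, ∀ j, ‖γ j‖ * (r * ε) < 1 := by
    refine eventually_all.mpr fun j => ?_
    have : Tendsto (fun ε : ℝ => ‖γ j‖ * (r * ε)) (𝓝[>] 0) (𝓝 (‖γ j‖ * (r * 0))) :=
      (Continuous.tendsto (by fun_prop) 0).mono_left nhdsWithin_le_nhds
    rw [mul_zero, mul_zero] at this
    exact this.eventually_lt_const one_pos
  filter_upwards [h, hsmall, self_mem_nhdsWithin] with ε h hs hpos
  exact ⟨hpos, hC, hδ, fun j u => (h j u).1, fun j u => (h j u).2.1, fun j u => (h j u).2.2, hs⟩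

variable {r : ℕ} {γ : Fin r → ℂ} {C δ : Fin r → ℝ} {ε : ℝ}

theorem IsAdmissible.norm_genProduct_le (h : IsAdmissible γ C δ ε) (u : Fin r → ℝ) :
    ‖genProduct γ fun k => hankelPath ε (u k)‖ ≤
      1 * ∏ j, (C j * Real.exp (-δ j * (hankelRadius ε (u j) - ε))) := by
  rw [genProduct, norm_prod, one_mul]
  exact Finset.prod_le_prod (fun _ _ => norm_nonneg _) fun j _ => h.norm_genFactor_le j u

theorem IsAdmissible.norm_regProduct_le (h : IsAdmissible γ C δ ε) {c : ℝ}
    (hc : c ∈ Set.Icc (1 / 2 : ℝ) (3 / 2)) (u : Fin r → ℝ) :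
    ‖regProduct γ c fun k => hankelPath ε (u k)‖ ≤
      |c - 1| ^ r * ∏ j, (C j * Real.exp (-δ j * (hankelRadius ε (u j) - ε))) := by
  rw [regProduct, norm_prod]
  refine (Finset.prod_le_prod (fun _ _ => norm_nonneg _)
    fun j _ => h.norm_regFactor_le j u c hc).trans_eq ?_
  rw [Finset.prod_mul_distrib, Finset.prod_const, Finset.card_univ, Fintype.card_fin, mul_comm]

theorem IsAdmissible.integrable_regProduct (h : IsAdmissible γ C δ ε) {c : ℝ}
    (hc : c ∈ Set.Icc (1 / 2 : ℝ) (3 / 2)) (s : Fin r → ℂ) :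
    Integrable (hankelIntegrand ε (regProduct γ c) s) := by
  obtain ⟨A, hA, hs⟩ := exists_norm_sub_one_le s
  exact (integrable_prod_hankelMajorant h.pos hA h.const_nonneg h.rate_pos _).mono'
    (measurable_hankelIntegrand ε (measurable_regProduct γ c) s).aestronglyMeasurable
    (ae_norm_hankelIntegrand_le h.pos.le (by positivity) h.const_nonneg hs
      (h.norm_regProduct_le hc))

theorem IsAdmissible.integrable_genProduct (h : IsAdmissible γ C δ ε) (s : Fin r → ℂ) :
    Integrable (hankelIntegrand ε (genProduct γ) s) := by
  obtain ⟨A, hA, hs⟩ := exists_norm_sub_one_le s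
  exact (integrable_prod_hankelMajorant h.pos hA h.const_nonneg h.rate_pos _).mono'
    (measurable_hankelIntegrand ε (measurable_genProduct γ) s).aestronglyMeasurable
    (ae_norm_hankelIntegrand_le h.pos.le zero_le_one h.const_nonneg hs h.norm_genProduct_le)

theorem mul_hankelIntegrand (a : ℂ) (G : (Fin r → ℂ) → ℂ) (s : Fin r → ℂ) (u : Fin r → ℝ) :
    a * hankelIntegrand ε G s u = hankelIntegrand ε (fun t => a * G t) s u := by
  rw [hankelIntegrand, hankelIntegrand, mul_assoc]

theorem eventually_mem_Icc_and_ne_one :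
    ∀ᶠ c : ℝ in 𝓝[≠] 1, c ∈ Set.Icc (1 / 2 : ℝ) (3 / 2) ∧ c ≠ 1 :=
  (eventually_nhdsWithin_of_eventually_nhds
    (Icc_mem_nhds (by norm_num) (by norm_num))).and self_mem_nhdsWithin

/-- Dominated convergence: the factor `|c - 1| ^ r` in the bound for `regProduct` cancels the
normalisation, leaving a majorant independent of `c`. -/
theorem IsAdmissible.tendsto_hankelIntegral (h : IsAdmissible γ C δ ε) (s : Fin r → ℂ) :
    Tendsto (fun c : ℝ => (-1) ^ r / ((c : ℂ) - 1) ^ r * hankelIntegral ε (regProduct γ c) s)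
      (𝓝[≠] 1) (𝓝 (hankelIntegral ε (genProduct γ) s)) := by
  obtain ⟨A, hA, hs⟩ := exists_norm_sub_one_le s
  simp only [hankelIntegral, ← integral_const_mul, mul_hankelIntegrand]
  refine tendsto_integral_filter_of_dominated_convergence
    (fun u => 1 * ∏ j, hankelMajorant ε A (C j) (δ j) (u j)) ?_ ?_
    (integrable_prod_hankelMajorant h.pos hA h.const_nonneg h.rate_pos _) ?_
  · exact Eventually.of_forall fun c => (measurable_hankelIntegrand ε
      ((measurable_regProduct γ c).const_mul _) s).aestronglyMeasurable
  · filter_upwards [eventually_mem_Icc_and_ne_one] with c hc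
    refine ae_norm_hankelIntegrand_le h.pos.le zero_le_one h.const_nonneg hs fun u => ?_
    have hc1 : 0 < |c - 1| := abs_pos.mpr (sub_ne_zero.mpr hc.2)
    have hcn : ‖(c : ℂ) - 1‖ = |c - 1| := by
      rw [← Complex.ofReal_one, ← Complex.ofReal_sub, Complex.norm_real, Real.norm_eq_abs]
    rw [norm_mul, norm_div, norm_pow, norm_pow, norm_neg, norm_one, one_pow, hcn]
    calc _ ≤ 1 / |c - 1| ^ r *
          (|c - 1| ^ r * ∏ j, (C j * Real.exp (-δ j * (hankelRadius ε (u j) - ε)))) := by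
          gcongr
          exact h.norm_regProduct_le hc.1 u
      _ = _ := by
          rw [← mul_assoc, one_div, inv_mul_cancel₀ (pow_ne_zero r hc1.ne')]
  · refine ae_of_all _ fun u => ?_
    refine Tendsto.mul_const _ ?_
    have hlim := (tendsto_finsetProd Finset.univ fun j _ =>
      tendsto_regFactor_div (h.exp_sub_one_ne_zero j u)).const_mul ((-1 : ℂ) ^ r)
    have he : (-1 : ℂ) ^ r * ∏ j, -genFactor (tailSum γ (fun k => hankelPath ε (u k)) j) =
        genProduct γ fun k => hankelPath ε (u k) := by
      rw [Finset.prod_neg, Finset.card_univ, Fintype.card_fin, ← mul_assoc, ← mul_pow]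
      simp [genProduct]
    rw [he] at hlim
    refine hlim.congr fun c => ?_
    simp only [regProduct, Finset.prod_div_distrib, Finset.prod_const, Finset.card_univ,
      Fintype.card_fin]
    ring

theorem IsAdmissible.continuous_hankelIntegral (h : IsAdmissible γ C δ ε) :
    Continuous (hankelIntegral ε (genProduct γ)) := by
  refine continuous_iff_continuousAt.mpr fun s₀ => ?_
  obtain ⟨A, hA, hs⟩ := exists_norm_sub_one_le s₀
  refine continuousAt_of_dominated (F := fun s => hankelIntegrand ε (genProduct γ) s)
    -- `A + 1` bounds every `‖s k - 1‖` for `s` within distance `1` of `s₀`.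
    (bound := fun u => 1 * ∏ j, hankelMajorant ε (A + 1) (C j) (δ j) (u j)) ?_ ?_
    (integrable_prod_hankelMajorant h.pos (by positivity) h.const_nonneg h.rate_pos _) ?_
  · exact Eventually.of_forall fun s =>
      (measurable_hankelIntegrand ε (measurable_genProduct γ) s).aestronglyMeasurable
  · filter_upwards [Metric.closedBall_mem_nhds s₀ one_pos] with s hs1
    refine ae_norm_hankelIntegrand_le h.pos.le zero_le_one h.const_nonneg (fun k => ?_)
      h.norm_genProduct_le
    have h1 : ‖s k - s₀ k‖ ≤ 1 :=
      (norm_le_pi_norm (s - s₀) k).trans (by rw [← dist_eq_norm]; exact hs1)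
    calc ‖s k - 1‖ = ‖(s₀ k - 1) + (s k - s₀ k)‖ := by congr 1; ring
      _ ≤ A + 1 := (norm_add_le _ _).trans (add_le_add (hs k) h1)
  · refine ae_of_all _ fun u => Continuous.continuousAt ?_
    unfold hankelIntegrand
    fun_prop

/-! ### The prefactor -/

/-- Since `e^(2πis) - 1 = 2i e^(πis) sin(πs)`, the reflection formula cancels the sine. The
right-hand side remains regular at the non-positive integers. -/
theorem one_div_exp_sub_one_mul_Gamma {s : ℂ} (hs : ∀ n : ℤ, s ≠ n) :
    1 / ((Complex.exp (2 * Real.pi * Complex.I * s) - 1) * Complex.Gamma s) =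
      Complex.Gamma (1 - s) * Complex.exp (-(Real.pi * Complex.I * s)) / (2 * Real.pi * Complex.I) := by
  have hpi : (Real.pi : ℂ) ≠ 0 := Complex.ofReal_ne_zero.mpr Real.pi_ne_zero
  have hsin : Complex.sin (Real.pi * s) ≠ 0 := by
    rw [Ne, Complex.sin_eq_zero_iff]
    rintro ⟨n, hn⟩
    rw [mul_comm] at hn
    exact hs n (mul_right_cancel₀ hpi hn)
  have hG := Complex.Gamma_mul_Gamma_one_sub s
  have hΓ : Complex.Gamma s ≠ 0 := by
    intro h0
    rw [h0, zero_mul] at hG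
    exact div_ne_zero hpi hsin hG.symm
  have hΓ' : Complex.Gamma (1 - s) = Real.pi / Complex.sin (Real.pi * s) / Complex.Gamma s := by
    rw [← hG]; field_simp
  have he : Complex.exp (2 * Real.pi * Complex.I * s) - 1 =
      Complex.exp (Real.pi * Complex.I * s) * (2 * Complex.I * Complex.sin (Real.pi * s)) := by
    rw [Complex.sin, show (2 * Real.pi * Complex.I * s : ℂ) =
      Real.pi * Complex.I * s + Real.pi * Complex.I * s by ring, Complex.exp_add,
      show -(Real.pi * s) * Complex.I = -(Real.pi * Complex.I * s) by ring,
      show (Real.pi * s) * Complex.I = Real.pi * Complex.I * s by ring, Complex.exp_neg]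
    have := Complex.exp_ne_zero (Real.pi * Complex.I * s)
    field_simp
    rw [Complex.I_sq]
    ring
  have := Complex.exp_ne_zero (Real.pi * Complex.I * s)
  rw [he, hΓ', Complex.exp_neg]
  field_simp

/-- The continuous extension of `1 / ((e^(2πis) - 1) Γ(s))` to the non-positive integers. -/
noncomputable def prefactor (s : ℂ) : ℂ :=
  Complex.Gamma (1 - s) * Complex.exp (-(Real.pi * Complex.I * s)) / (2 * Real.pi * Complex.I)

theorem continuousAt_prefactor (k : ℕ) : ContinuousAt prefactor (-(k : ℂ)) := by
  have h1 : ContinuousAt Complex.Gamma (1 - -(k : ℂ)) := by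
    rw [sub_neg_eq_add, add_comm]
    refine (Complex.differentiableAt_Gamma _ fun m hm => ?_).continuousAt
    have : ((k + 1 + m : ℕ) : ℂ) = 0 := by push_cast; rw [hm]; ring
    exact absurd (Nat.cast_eq_zero.mp this) (by omega)
  have h2 : ContinuousAt (fun s : ℂ => Complex.Gamma (1 - s)) (-(k : ℂ)) :=
    ContinuousAt.comp (f := fun s : ℂ => 1 - s) h1 (by fun_prop)
  exact (h2.mul (by fun_prop)).div_const _

theorem prefactor_neg_natCast (k : ℕ) :
    prefactor (-(k : ℂ)) = (-1) ^ k * k ! / (2 * Real.pi * Complex.I) := by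
  rw [prefactor, sub_neg_eq_add, add_comm, Complex.Gamma_nat_eq_factorial,
    show -(Real.pi * Complex.I * -(k : ℂ)) = k * (Real.pi * Complex.I) by ring,
    Complex.exp_nat_mul, Complex.exp_pi_mul_I, mul_comm]

theorem IsAdmissible.tendsto_desZetaApprox (h : IsAdmissible γ C δ ε) {s : Fin r → ℂ}
    (hs : s ∈ nonIntegral r) :
    Tendsto (fun c : ℝ => desZetaApprox ε γ c s) (𝓝[≠] 1)
      (𝓝 ((∏ k, prefactor (s k)) * hankelIntegral ε (genProduct γ) s)) := by
  refine ((h.tendsto_hankelIntegral s).const_mul (∏ k, prefactor (s k))).congr fun c => ?_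
  rw [desZetaApprox]
  simp only [fun k => one_div_exp_sub_one_mul_Gamma (hs k), prefactor]
  ring

theorem IsAdmissible.desZetaGeneric_eq (h : IsAdmissible γ C δ ε) {s : Fin r → ℂ}
    (hs : s ∈ nonIntegral r) :
    desZetaGeneric ε γ s = (∏ k, prefactor (s k)) * hankelIntegral ε (genProduct γ) s :=
  (h.tendsto_desZetaApprox hs).limUnder_eq

theorem IsAdmissible.tendsto_desZetaGeneric (h : IsAdmissible γ C δ ε) (k : Fin r → ℕ) :
    Tendsto (desZetaGeneric ε γ) (𝓝[nonIntegral r] (fun j => -(k j : ℂ)))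
      (𝓝 ((∏ j, prefactor (-(k j : ℂ))) *
        hankelIntegral ε (genProduct γ) fun j => -(k j : ℂ))) := by
  have hc : ContinuousAt
      (fun s : Fin r → ℂ => (∏ j, prefactor (s j)) * hankelIntegral ε (genProduct γ) s)
      (fun j => -(k j : ℂ)) := by
    refine ContinuousAt.mul ?_ h.continuous_hankelIntegral.continuousAt
    refine tendsto_finsetProd _ fun j _ => ?_
    exact ContinuousAt.comp (f := fun s : Fin r → ℂ => s j) (x := fun j => -(k j : ℂ))
      (continuousAt_prefactor (k j)) (continuous_apply j).continuousAt
  refine (hc.tendsto.mono_left nhdsWithin_le_nhds).congr' ?_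
  filter_upwards [self_mem_nhdsWithin] with s hs
  exact (h.desZetaGeneric_eq hs).symm

/-- Needed for limits along this filter to be unique; the points `-k_j + ix` with `x > 0` approach
within `nonIntegral r`. -/
theorem neBot_nhdsWithin_nonIntegral (k : Fin r → ℕ) :
    (𝓝[nonIntegral r] (fun j => -(k j : ℂ))).NeBot := by
  have hlim : Tendsto (fun (x : ℝ) (j : Fin r) => -(k j : ℂ) + x * Complex.I) (𝓝[>] 0)
      (𝓝[nonIntegral r] (fun j => -(k j : ℂ))) := by
    refine tendsto_nhdsWithin_iff.mpr ⟨?_, ?_⟩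
    · have : Continuous fun (x : ℝ) (j : Fin r) => -(k j : ℂ) + x * Complex.I := by fun_prop
      simpa using (this.tendsto 0).mono_left nhdsWithin_le_nhds
    · filter_upwards [self_mem_nhdsWithin] with x hx j n hn
      have := congrArg Complex.im hn
      simp at this
      exact (ne_of_gt hx) this
  exact hlim.neBot

/-! ### Reduction to the circle at integral points -/

/-- Reflection of the `i`-th parameter, which interchanges the two sides of the contour. -/
noncomputable def reflectCoord {r : ℕ} (i : Fin r) (u : Fin r → ℝ) : Fin r → ℝ :=
  fun j => if j = i then 2 * Real.pi - u j else u j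

theorem measurePreserving_reflectCoord {r : ℕ} (i : Fin r) :
    MeasurePreserving (reflectCoord i) := by
  refine volume_preserving_pi (f := fun j x => if j = i then 2 * Real.pi - x else x) fun j => ?_
  by_cases h : j = i
  · simpa [h] using Measure.measurePreserving_sub_left volume (2 * Real.pi)
  · simp only [h, if_false]
    exact MeasurePreserving.id volume

theorem reflectCoord_reflectCoord {r : ℕ} (i : Fin r) (u : Fin r → ℝ) :
    reflectCoord i (reflectCoord i u) = u := by
  funext j
  by_cases h : j = i <;> simp [reflectCoord, h]

theorem measurableEmbedding_reflectCoord {r : ℕ} (i : Fin r) :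
    MeasurableEmbedding (reflectCoord i) :=
  (MeasurableEquiv.mk (Function.Involutive.toPerm _ (reflectCoord_reflectCoord i))
    (measurePreserving_reflectCoord i).measurable
    (measurePreserving_reflectCoord i).measurable).measurableEmbedding

theorem two_pi_sub_mem_Icc_iff {x : ℝ} :
    2 * Real.pi - x ∈ Set.Icc 0 (2 * Real.pi) ↔ x ∈ Set.Icc 0 (2 * Real.pi) := by
  simp only [Set.mem_Icc]
  constructor <;> rintro ⟨h1, h2⟩ <;> constructor <;> linarith

/-- Coordinates are confined to the circle one at a time. The discarded region is invariant under
the measure-preserving reflection, which changes the sign of `f`, so its integral equals its own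
negative. -/
theorem integral_eq_setIntegral_of_reflect_neg {r : ℕ} {f : (Fin r → ℝ) → ℂ} (hf : Integrable f)
    (hneg : ∀ i u, u i ∉ Set.Icc 0 (2 * Real.pi) → f (reflectCoord i u) = -f u) :
    ∫ u, f u = ∫ u in Set.univ.pi fun _ => Set.Icc 0 (2 * Real.pi), f u := by
  have key : ∀ S : Finset (Fin r),
      ∫ u, f u = ∫ u in (S : Set (Fin r)).pi fun _ => Set.Icc 0 (2 * Real.pi), f u := by
    intro S
    induction S using Finset.induction_on with
    | empty => simp
    | insert i S hi ih =>
      set E : Set (Fin r → ℝ) := (S : Set (Fin r)).pi fun _ => Set.Icc 0 (2 * Real.pi)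
      set T : Set (Fin r → ℝ) := {u | u i ∈ Set.Icc 0 (2 * Real.pi)}
      have hT : MeasurableSet T := measurableSet_Icc.preimage (measurable_pi_apply i)
      have hE : MeasurableSet E := MeasurableSet.pi (Finset.countable_toSet S)
        fun _ _ => measurableSet_Icc
      have hpi : ((insert i S : Finset (Fin r)) : Set (Fin r)).pi
          (fun _ => Set.Icc 0 (2 * Real.pi)) = E ∩ T := by
        rw [Finset.coe_insert, Set.insert_pi, Set.inter_comm]
        rfl
      have hpre : reflectCoord i ⁻¹' (E \ T) = E \ T := by
        ext u
        have h1 : reflectCoord i u ∈ T ↔ u ∈ T := by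
          simpa [T, reflectCoord] using two_pi_sub_mem_Icc_iff (x := u i)
        have h2 : reflectCoord i u ∈ E ↔ u ∈ E := by
          refine forall₂_congr fun j hj => ?_
          -- The coordinates already confined are untouched by the reflection in `i ∉ S`.
          have : j ≠ i := fun h => hi (by rw [← h]; exact_mod_cast hj)
          simp [reflectCoord, this]
        simp [h1, h2]
      have hzero : ∫ u in E \ T, f u = 0 := by
        have h1 := (measurePreserving_reflectCoord i).setIntegral_preimage_emb
          (measurableEmbedding_reflectCoord i) f (E \ T)
        rw [hpre, setIntegral_congr_fun (g := fun u => -f u) (hE.diff hT)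
          fun u hu => hneg i u hu.2, integral_neg] at h1
        exact self_eq_neg.mp h1.symm
      rw [ih, hpi, ← integral_inter_add_sdiff hT hf.integrableOn, hzero, add_zero]
  simpa using key Finset.univ

theorem exp_hankelLog {ε : ℝ} (hε : 0 < ε) (u : ℝ) :
    Complex.exp (hankelLog ε u) = hankelPath ε u := by
  have hR : hankelRadius ε u ≠ 0 := (hε.trans_le (le_hankelRadius ε u)).ne'
  rw [hankelLog, Complex.exp_add, Complex.ofReal_log (hε.trans_le (le_hankelRadius ε u)).le,
    Complex.exp_log (Complex.ofReal_ne_zero.mpr hR), hankelPath]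

theorem exp_neg_natCast_sub_one_mul_hankelLog {ε : ℝ} (hε : 0 < ε) (k : ℕ) (u : ℝ) :
    Complex.exp ((-(k : ℂ) - 1) * hankelLog ε u) = (hankelPath ε u ^ (k + 1))⁻¹ := by
  rw [← exp_hankelLog hε, ← Complex.exp_nat_mul, ← Complex.exp_neg]
  congr 1
  push_cast
  ring

theorem hankelIntegrand_neg_natCast {r : ℕ} {ε : ℝ} (hε : 0 < ε) (G : (Fin r → ℂ) → ℂ)
    (k : Fin r → ℕ) (u : Fin r → ℝ) :
    hankelIntegrand ε G (fun j => -(k j : ℂ)) u = G (fun j => hankelPath ε (u j)) *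
      ∏ j, ((hankelPath ε (u j) ^ (k j + 1))⁻¹ * deriv (hankelPath ε) (u j)) := by
  simp only [hankelIntegrand, exp_neg_natCast_sub_one_mul_hankelLog hε]

/-- At integral exponents the integrand depends only on the points of the contour and the direction
of travel. Reflection keeps the points and reverses the direction in one coordinate. -/
theorem hankelIntegrand_reflectCoord {r : ℕ} {ε : ℝ} (hε : 0 < ε) (G : (Fin r → ℂ) → ℂ)
    (k : Fin r → ℕ) (i : Fin r) {u : Fin r → ℝ} (hu : u i ∉ Set.Icc 0 (2 * Real.pi)) :
    hankelIntegrand ε G (fun j => -(k j : ℂ)) (reflectCoord i u) =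
      -hankelIntegrand ε G (fun j => -(k j : ℂ)) u := by
  have hpath : ∀ j, hankelPath ε (reflectCoord i u j) = hankelPath ε (u j) := by
    intro j
    rw [reflectCoord]
    split_ifs with h
    · rw [h, hankelPath_two_pi_sub hu]
    · rfl
  have hderiv : ∀ j, deriv (hankelPath ε) (reflectCoord i u j) =
      (if j = i then -1 else 1) * deriv (hankelPath ε) (u j) := by
    intro j
    rw [reflectCoord]
    split_ifs with h
    · rw [h, deriv_hankelPath_two_pi_sub hu]; ring
    · rw [one_mul]
  rw [hankelIntegrand_neg_natCast hε, hankelIntegrand_neg_natCast hε]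
  simp only [hpath, hderiv, Finset.prod_mul_distrib, Finset.prod_ite_eq', Finset.mem_univ, if_true]
  ring

/-! ### The integral over the product of circles -/

theorem integral_exp_int_mul_I (n : ℤ) :
    ∫ u in (0 : ℝ)..2 * Real.pi, Complex.exp (n * Complex.I * u) =
      if n = 0 then 2 * Real.pi else 0 := by
  split_ifs with h
  · simp [h]
  · rw [integral_exp_mul_complex (mul_ne_zero (Int.cast_ne_zero.mpr h) Complex.I_ne_zero)]
    push_cast
    rw [show (n * Complex.I * (2 * Real.pi) : ℂ) = n * (2 * Real.pi * Complex.I) by ring,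
      Complex.exp_int_mul_two_pi_mul_I]
    simp

theorem circle_monomial_eq {ε : ℝ} (hε : 0 < ε) (m k : ℕ) {u : ℝ}
    (hu : u ∈ Set.Ioo 0 (2 * Real.pi)) :
    hankelPath ε u ^ m * ((hankelPath ε u ^ (k + 1))⁻¹ * deriv (hankelPath ε) u) =
      (ε : ℂ) ^ ((m : ℤ) - k) * Complex.I * Complex.exp (((m - k : ℤ) : ℂ) * Complex.I * u) := by
  have hε' : (ε : ℂ) ≠ 0 := Complex.ofReal_ne_zero.mpr hε.ne'
  have hz := Complex.exp_ne_zero (u * Complex.I)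
  rw [deriv_hankelPath_of_mem_Ioo hu, hankelPath_of_mem_Icc ⟨hu.1.le, hu.2.le⟩,
    show (((m - k : ℤ) : ℂ) * Complex.I * u) = ((m - k : ℤ) : ℂ) * (u * Complex.I) by ring,
    Complex.exp_int_mul, zpow_sub₀ hε', zpow_sub₀ hz, zpow_natCast, zpow_natCast, zpow_natCast,
    zpow_natCast]
  field_simp
  ring

theorem ae_restrict_mem_Ioo :
    ∀ᵐ u ∂(volume : Measure ℝ).restrict (Set.Icc 0 (2 * Real.pi)),
      u ∈ Set.Ioo 0 (2 * Real.pi) := by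
  rw [restrict_Ioo_eq_restrict_Icc.symm]
  exact ae_restrict_mem measurableSet_Ioo

theorem integrable_circle_monomial {ε : ℝ} (hε : 0 < ε) (m k : ℕ) :
    Integrable (fun u => hankelPath ε u ^ m * ((hankelPath ε u ^ (k + 1))⁻¹ *
      deriv (hankelPath ε) u)) (volume.restrict (Set.Icc 0 (2 * Real.pi))) := by
  have h : Integrable (fun u : ℝ => (ε : ℂ) ^ ((m : ℤ) - k) * Complex.I *
      Complex.exp (((m - k : ℤ) : ℂ) * Complex.I * u))
      (volume.restrict (Set.Icc 0 (2 * Real.pi))) :=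
    (Continuous.continuousOn (by fun_prop)).integrableOn_compact isCompact_Icc
  refine h.congr ?_
  filter_upwards [ae_restrict_mem_Ioo] with u hu
  exact (circle_monomial_eq hε m k hu).symm

theorem integral_circle_monomial {ε : ℝ} (hε : 0 < ε) (m k : ℕ) :
    ∫ u in Set.Icc 0 (2 * Real.pi), hankelPath ε u ^ m * ((hankelPath ε u ^ (k + 1))⁻¹ *
      deriv (hankelPath ε) u) = if m = k then 2 * Real.pi * Complex.I else 0 := by
  rw [integral_congr_ae (ae_restrict_mem_Ioo.mono fun u hu => circle_monomial_eq hε m k hu),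
    integral_const_mul, integral_Icc_eq_integral_Ioc,
    ← intervalIntegral.integral_of_le (by positivity), integral_exp_int_mul_I]
  by_cases h : m = k
  · simp [h, mul_comm]
  · have h' : (m : ℤ) - k ≠ 0 := by omega
    simp [h, h']

theorem integral_norm_circle_monomial {ε : ℝ} (hε : 0 < ε) (m k : ℕ) :
    ∫ u in Set.Icc 0 (2 * Real.pi), ‖hankelPath ε u ^ m * ((hankelPath ε u ^ (k + 1))⁻¹ *
      deriv (hankelPath ε) u)‖ = ε ^ m * (2 * Real.pi / ε ^ k) := by
  have h : ∀ u ∈ Set.Ioo 0 (2 * Real.pi), ‖hankelPath ε u ^ m * ((hankelPath ε u ^ (k + 1))⁻¹ *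
      deriv (hankelPath ε) u)‖ = ε ^ m / ε ^ k := by
    intro u hu
    rw [circle_monomial_eq hε m k hu,
      show (((m - k : ℤ) : ℂ) * Complex.I * u) = ((m - k : ℤ) * u : ℝ) * Complex.I by
        push_cast; ring]
    rw [norm_mul, norm_mul, norm_zpow, Complex.norm_exp_ofReal_mul_I, Complex.norm_I,
      Complex.norm_real, Real.norm_of_nonneg hε.le, zpow_sub₀ hε.ne', zpow_natCast, zpow_natCast]
    ring
  rw [integral_congr_ae (ae_restrict_mem_Ioo.mono h), integral_const]
  simp [Real.pi_pos.le]
  ring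

theorem norm_hankelPath_of_mem_Icc {ε u : ℝ} (hε : 0 ≤ ε) (h : u ∈ Set.Icc 0 (2 * Real.pi)) :
    ‖hankelPath ε u‖ = ε := by
  rw [hankelPath_of_mem_Icc h, norm_mul, Complex.norm_exp_ofReal_mul_I, Complex.norm_real,
    Real.norm_of_nonneg hε, mul_one]

theorem hasSum_genProduct_hankelPath (hε : 0 ≤ ε) (hsmall : ∀ j, ‖γ j‖ * (r * ε) < 1)
    {u : Fin r → ℝ} (hu : ∀ j, u j ∈ Set.Icc 0 (2 * Real.pi)) :
    HasSum (fun m : Fin r → ℕ => genCoeff γ m * ∏ j, hankelPath ε (u j) ^ m j)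
      (genProduct γ fun j => hankelPath ε (u j)) := by
  refine hasSum_prod_genFactor (t := fun j => hankelPath ε (u j)) fun j => ?_
  simpa [norm_hankelPath_of_mem_Icc hε (hu _)] using hsmall j

theorem summable_norm_genCoeff (hε : 0 ≤ ε) (hsmall : ∀ j, ‖γ j‖ * (r * ε) < 1) :
    Summable fun m : Fin r → ℕ => ‖genCoeff γ m‖ * ∏ j, ε ^ m j := by
  have h := (hasSum_prod_genFactor (γ := γ) (t := fun _ => (ε : ℂ)) fun j => by
    simpa [abs_of_nonneg hε] using hsmall j).summable.norm
  simpa [norm_mul, norm_prod, abs_of_nonneg hε] using h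

/-- Cauchy's coefficient formula on the polycircle: the Taylor series is integrated term by term,
and orthogonality of the exponentials leaves only `m = k`. -/
theorem setIntegral_circles (hε : 0 < ε) (hsmall : ∀ j, ‖γ j‖ * (r * ε) < 1) (k : Fin r → ℕ) :
    ∫ u in Set.univ.pi fun _ => Set.Icc 0 (2 * Real.pi),
      hankelIntegrand ε (genProduct γ) (fun j => -(k j : ℂ)) u =
      genCoeff γ k * (2 * Real.pi * Complex.I) ^ r := by
  set μ : Measure ℝ := volume.restrict (Set.Icc 0 (2 * Real.pi)) with hμ
  set e : ℕ → ℕ → ℝ → ℂ := fun m k u =>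
    hankelPath ε u ^ m * ((hankelPath ε u ^ (k + 1))⁻¹ * deriv (hankelPath ε) u) with he
  set F : (Fin r → ℕ) → (Fin r → ℝ) → ℂ := fun m u => genCoeff γ m * ∏ j, e (m j) (k j) (u j)
  have hint : ∀ m, Integrable (F m) (Measure.pi fun _ => μ) := fun m =>
    (Integrable.fintype_prod fun j => integrable_circle_monomial hε (m j) (k j)).const_mul _
  have hnorm : Summable fun m => ∫ u, ‖F m u‖ ∂(Measure.pi fun _ => μ) := by
    have h1 := (summable_norm_genCoeff hε.le hsmall).mul_right (∏ j, (2 * Real.pi / ε ^ k j))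
    refine h1.congr fun m => ?_
    simp only [F, norm_mul, norm_prod]
    rw [integral_const_mul, mul_assoc, ← Finset.prod_mul_distrib]
    congr 1
    rw [integral_fintype_prod_eq_prod (f := fun j u => ‖e (m j) (k j) u‖)]
    exact Finset.prod_congr rfl fun j _ => (integral_norm_circle_monomial hε (m j) (k j)).symm
  have hsum := hasSum_integral_of_summable_integral_norm hint hnorm
  have hval : ∀ m, ∫ u, F m u ∂(Measure.pi fun _ => μ) =
      if m = k then genCoeff γ k * (2 * Real.pi * Complex.I) ^ r else 0 := by
    intro m
    simp only [F]
    rw [integral_const_mul, integral_fintype_prod_eq_prod (f := fun j u => e (m j) (k j) u)]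
    simp only [e, hμ, integral_circle_monomial hε]
    split_ifs with h
    · simp [h]
    · obtain ⟨j, hj⟩ := Function.ne_iff.mp h
      rw [Finset.prod_eq_zero (Finset.mem_univ j) (if_neg hj), mul_zero]
  simp only [hval] at hsum
  have hae : ∀ᵐ u ∂(volume : Measure (Fin r → ℝ)).restrict
      (Set.univ.pi fun _ => Set.Icc 0 (2 * Real.pi)),
      ∑' m, F m u = hankelIntegrand ε (genProduct γ) (fun j => -(k j : ℂ)) u := by
    filter_upwards [ae_restrict_mem (MeasurableSet.univ_pi fun _ => measurableSet_Icc)] with u hu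
    rw [hankelIntegrand_neg_natCast hε]
    refine (((hasSum_genProduct_hankelPath hε.le hsmall fun j => hu j (Set.mem_univ j)).mul_right
      _).congr_fun ?_).tsum_eq
    intro m
    simp only [F, e, Finset.prod_mul_distrib]
    ring
  rw [← integral_congr_ae hae, volume_pi, Measure.restrict_pi_pi]
  exact hsum.unique (hasSum_ite_eq k _)

theorem IsAdmissible.hankelIntegral_neg_natCast (h : IsAdmissible γ C δ ε) (k : Fin r → ℕ) :
    hankelIntegral ε (genProduct γ) (fun j => -(k j : ℂ)) =
      genCoeff γ k * (2 * Real.pi * Complex.I) ^ r := by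
  rw [hankelIntegral, integral_eq_setIntegral_of_reflect_neg (h.integrable_genProduct _)
    fun i u hu => hankelIntegrand_reflectCoord h.pos _ k i hu,
    setIntegral_circles h.pos h.radius_small k]

/-! ### Values at non-positive integers -/

theorem IsAdmissible.tendsto_desZetaGeneric_genCoeff (h : IsAdmissible γ C δ ε)
    (k : Fin r → ℕ) :
    Tendsto (desZetaGeneric ε γ) (𝓝[nonIntegral r] (fun j => -(k j : ℂ)))
      (𝓝 ((∏ l, (-1) ^ k l * ((k l)! : ℂ)) * genCoeff γ k)) := by
  have h1 := h.tendsto_desZetaGeneric k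
  rw [h.hankelIntegral_neg_natCast k] at h1
  convert h1 using 2
  simp only [prefactor_neg_natCast]
  rw [Finset.prod_div_distrib, Finset.prod_const, Finset.card_univ, Fintype.card_fin]
  have : (2 * Real.pi * Complex.I : ℂ) ^ r ≠ 0 := pow_ne_zero r Complex.two_pi_I_ne_zero
  field_simp

theorem desZeta_neg_natCast (hγ : ∀ j, 0 < (γ j).re) (k : Fin r → ℕ) :
    desZeta γ (fun j => -(k j : ℂ)) = (∏ l, (-1) ^ k l * ((k l)! : ℂ)) * genCoeff γ k := by
  obtain ⟨C, δ, h⟩ := eventually_isAdmissible hγ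
  have := neBot_nhdsWithin_nonIntegral k
  -- The inner limit is the same for every admissible radius, so the outer limit is that of an
  -- eventually constant function.
  refine Tendsto.limUnder_eq (tendsto_const_nhds.congr' ?_)
  filter_upwards [h] with ε h
  exact (h.tendsto_desZetaGeneric_genCoeff k).limUnder_eq.symm

theorem hasSum_desZeta (hγ : ∀ j, 0 < (γ j).re) {t : Fin r → ℂ}
    (ht : ∀ j, ‖γ j‖ * ∑ l, ‖t l‖ < 1) :
    HasSum
      (fun m : Fin r → ℕ => (-1) ^ (∑ j, m j) * desZeta γ (fun j => -(m j : ℂ)) *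
        ∏ j, (t j ^ m j / ((m j)! : ℂ)))
      (∏ j, genFactor (tailSum γ t j)) := by
  refine (hasSum_prod_genFactor ht).congr_fun fun m => ?_
  rw [desZeta_neg_natCast hγ, Finset.prod_mul_distrib, Finset.prod_div_distrib,
    Finset.prod_pow_eq_pow_sum]
  have hne : ∏ j, ((m j)! : ℂ) ≠ 0 :=
    Finset.prod_ne_zero_iff.mpr fun j _ => Nat.cast_ne_zero.mpr (Nat.factorial_ne_zero _)
  have hsq : (-1 : ℂ) ^ (∑ j, m j) * (-1) ^ (∑ j, m j) = 1 := by
    rw [← mul_pow]; simp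
  field_simp
  linear_combination (genCoeff γ m * ∏ j, t j ^ m j) * hsq

theorem eventually_norm_mul_sum_lt_one (γ : Fin r → ℂ) :
    ∀ᶠ t : Fin r → ℂ in 𝓝 0, ∀ j, ‖γ j‖ * ∑ l, ‖t l‖ < 1 := by
  refine eventually_all.mpr fun j => ?_
  have h : Continuous fun t : Fin r → ℂ => ‖γ j‖ * ∑ l, ‖t l‖ := by fun_prop
  have h0 := h.tendsto 0
  simp only [Pi.zero_apply, norm_zero, Finset.sum_const_zero, mul_zero] at h0
  exact h0.eventually_lt_const one_pos

end DesZeta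

theorem mainTheorem4 (r : ℕ) (γ : Fin r → ℂ) (hγ : ∀ j, 0 < (γ j).re) :
    -- the definition makes sense: for all sufficiently small radii the contour integrals converge
    -- absolutely, the limit as `c → 1` exists, and so does the value at every `(-k_j)`,
    -- independently of the radius
    (∀ᶠ ε : ℝ in 𝓝[>] 0,
      (∀ s ∈ DesZeta.nonIntegral r,
        (∀ᶠ c : ℝ in 𝓝[≠] 1,
          Integrable (DesZeta.hankelIntegrand ε (DesZeta.regProduct γ c) s)) ∧
        Tendsto (fun c : ℝ => DesZeta.desZetaApprox ε γ c s) (𝓝[≠] 1)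
          (𝓝 (DesZeta.desZetaGeneric ε γ s))) ∧
      ∀ k : Fin r → ℕ,
        Tendsto (DesZeta.desZetaGeneric ε γ)
          (𝓝[DesZeta.nonIntegral r] (fun j => -(k j : ℂ)))
          (𝓝 (DesZeta.desZeta γ (fun j => -(k j : ℂ))))) ∧
    -- the generating function
    (∀ᶠ t : Fin r → ℂ in 𝓝 0,
      HasSum
        (fun m : Fin r → ℕ =>
          (-1) ^ (∑ j, m j) * DesZeta.desZeta γ (fun j => -(m j : ℂ)) *
            ∏ j, (t j ^ m j / ((m j)! : ℂ)))
        (∏ j, DesZeta.genFactor (DesZeta.tailSum γ t j))) ∧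
    -- the explicit formula
    (∀ k : Fin r → ℕ,
      DesZeta.desZeta γ (fun j => -(k j : ℂ)) =
        (∏ l, (-1) ^ k l * ((k l)! : ℂ)) *
          ∑ ν ∈ DesZeta.nuIndex k,
            ∏ j,
              ((bernoulli (1 + ∑ l ∈ Finset.Ici j, ν l j) : ℂ) *
                γ j ^ (∑ l ∈ Finset.Ici j, ν l j) *
                (1 / ∏ d ∈ Finset.Iic j, ((ν j d)! : ℂ)))) := by
  obtain ⟨C, δ, h⟩ := DesZeta.eventually_isAdmissible hγ
  refine ⟨?_, ?_, fun k => DesZeta.desZeta_neg_natCast hγ k⟩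
  · filter_upwards [h] with ε h
    refine ⟨fun s hs => ⟨?_, ?_⟩, fun k => ?_⟩
    · filter_upwards [DesZeta.eventually_mem_Icc_and_ne_one] with c hc
      exact h.integrable_regProduct hc.1 s
    · rw [h.desZetaGeneric_eq hs]
      exact h.tendsto_desZetaApprox hs
    · rw [DesZeta.desZeta_neg_natCast hγ k]
      exact h.tendsto_desZetaGeneric_genCoeff k
  · filter_upwards [DesZeta.eventually_norm_mul_sum_lt_one γ] with t ht
    exact DesZeta.hasSum_desZeta hγ ht
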